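/- Let $D\subset\mathbb{C}$ be open and simply connected with $0\in D$, and let $H\in\mathbb{R}$ with $|H|>1$. Identify $\mathbb{R}^{3,1}$ with the Hermitian $2\times2$ matrices via $x\mapsto\begin{pmatrix}x^0+x^3&x^1+ix^2\\x^1-ix^2&x^0-x^3\end{pmatrix}$, so that $\mathbb{H}^3=\{\langle x,x\rangle=-1,\ x^0>0\}$ and $SL(2,\mathbb{C})$ acts by $x\mapsto gxg^*$; let $\sigma_1,\sigma_2,\sigma_3$ be the matrices of the coordinate vectors of $x^1,x^2,x^3$. Let $(f^\theta)_{\theta\in S^1}$ be an associated family of surfaces of constant mean curvature $H$: smooth conformal immersions $f^\theta:D\to\mathbb{H}^3$ with unit normals $N^\theta$, all with the same metric $e^{2u}\,dz\,d\bar z$ and the same mean curvature $H$, and with Hopf differentials $\langle f^\theta_{zz},N^\theta\rangle dz^2=\theta^{-2}Q\,dz^2$. Let $F(\theta):D\to SL(2,\mathbb{C})$ be smooth moving frames, i.e. $FF^*=f^\theta$, $F\sigma_1F^*=e^{-u}f^\theta_x$, $F\sigma_2F^*=e^{-u}f^\theta_y$, $F\sigma_3F^*=N^\theta$. For $s>0$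 and $\theta\in S^1$ put $\Omega(s,\theta)=A(s,\theta)\,dz+B(s,\theta)\,d\bar z$, where $$A(s,\theta)=\begin{pmatrix}\tfrac12u_z&\tfrac s2e^u(1+H)\\-e^{-u}\theta^{-2}Q&-\tfrac12u_z\end{pmatrix},\qquad B(s,\theta)=\begin{pmatrix}-\tfrac12u_{\bar z}&e^{-u}\theta^{2}\overline Q\\\tfrac{s^{-1}}2e^u(1-H)&\tfrac12u_{\bar z}\end{pmatrix}.$$ Then: 1. $F(\theta)^{-1}dF(\theta)=\Omega(1,\theta)$ for every $\theta\in S^1$; thus $\Omega(s,\theta)$ is the $s$-deformation $1+H\mapsto s(1+H)$, $1-H\mapsto s^{-1}(1-H)$ of the Maurer--Cartan form of $F(\theta)$. 2. The number $s_0=\sqrt{(H-1)/(H+1)}$ is positive, and for every $s>0$ and every $\theta\in S^1$ the form $\Omega(s,\theta)$ is $\mathfrak{su}(2)$-valued on $D$ if and only if $s=s_0$. 3. Let $G(\theta)=i\begin{pmatrix}0&\theta^{1/2}\\\theta^{-1/2}&0\end{pmatrix}$ and $\widetilde\Omega(\theta)=G(\theta)\,\Omega(s_0,\theta)\,G(\theta)^{-1}$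 (this does not depend on the choice of the root). For every $p>\tfrac12$ there is a unitary frame (the adjusted frame) $\widetilde F(\theta):D\to SU(2)$, $\theta\in S^1$, smooth on $D$ for each $\theta$, with $\widetilde F(\theta)(0)=I$ and $\widetilde F(\theta)^{-1}d\widetilde F(\theta)=\widetilde\Omega(\theta)$, such that for every $z\in D$ the loop $\theta\mapsto\widetilde F(\theta)(z)$ lies in the twisted loop group $\Lambda SU(2)$ of continuous maps $g:S^1\to SU(2)$ of Sobolev class $H^p$ with $g(-\theta)=\sigma_3\,g(\theta)\,\sigma_3^{-1}$. Moreover, for every $\theta\in S^1$, $\widetilde F(\theta)$ is a lift of a harmonic map $\widetilde N(\theta):D\to S^2$ (the adjusted Gauss map), namely of its natural projection $\widetilde N(\theta)=\widetilde F(\theta)\,\sigma_3\,\widetilde F(\theta)^{-1}$ to $S^2=SU(2)/U(1)$, where $S^2$ is the unit sphere in the space of trace-free Hermitian $2\times 2$ matrices, with orthonormal basis $\sigma_1,\sigma_2,\sigma_3$. -/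

import Mathlib

open Matrix Complex
open scoped ContDiff ComplexConjugate Laplacian

noncomputable section

namespace CMCHyp

/-- Complex `2 × 2` matrices. -/
abbrev Mat2 : Type := Matrix (Fin 2) (Fin 2) ℂ

/-! ### Derivatives in the plane, with `z = x + i y` -/

/-- The partial derivative `∂/∂x`. -/
def dx {E : Type*} [NormedAddCommGroup E] [NormedSpace ℝ E] (g : ℂ → E) (z : ℂ) : E :=
  fderiv ℝ g z 1

/-- The partial derivative `∂/∂y`. -/
def dy {E : Type*} [NormedAddCommGroup E] [NormedSpace ℝ E] (g : ℂ → E) (z : ℂ) : E :=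
  fderiv ℝ g z I

/-- The Wirtinger derivative `∂/∂z = (∂/∂x - i ∂/∂y) / 2`. -/
def wirt (g : ℂ → ℂ) (z : ℂ) : ℂ := (1 / 2) * (dx g z - I * dy g z)

/-- The Wirtinger derivative `∂/∂z̄ = (∂/∂x + i ∂/∂y) / 2`. -/
def wirtBar (g : ℂ → ℂ) (z : ℂ) : ℂ := (1 / 2) * (dx g z + I * dy g z)

/-- Entrywise `∂/∂z` of a matrix-valued map. -/
def wirtMat (F : ℂ → Mat2) (z : ℂ) : Mat2 := Matrix.of fun i j => wirt (fun w => F w i j) z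

/-- Entrywise `∂/∂z̄` of a matrix-valued map. -/
def wirtBarMat (F : ℂ → Mat2) (z : ℂ) : Mat2 := Matrix.of fun i j => wirtBar (fun w => F w i j) z

/-- A matrix-valued map is `C^∞` on `D` (entrywise, in the real sense). -/
def SmoothMat (D : Set ℂ) (F : ℂ → Mat2) : Prop :=
  ∀ i j, ContDiffOn ℝ ∞ (fun z => F z i j) D

/-- `F⁻¹ dF = A dz + B dz̄` on `D`, in the form of the Lax system `F_z = F A`, `F_z̄ = F B`,
for a smooth `F`. -/
structure HasMaurerCartanForm (D : Set ℂ) (F A B : ℂ → Mat2) : Prop where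
  smooth : SmoothMat D F
  dz_eq : ∀ z ∈ D, wirtMat F z = F z * A z
  dzbar_eq : ∀ z ∈ D, wirtBarMat F z = F z * B z

/-! ### Hyperbolic 3-space in Minkowski space -/

/-- The vector space of `ℝ^{3,1}`. -/
abbrev R31 : Type := Fin 4 → ℝ

/-- The Lorentzian scalar product `-x⁰y⁰ + x¹y¹ + x²y² + x³y³`. -/
def lor (x y : R31) : ℝ := -(x 0 * y 0) + x 1 * y 1 + x 2 * y 2 + x 3 * y 3

/-- Hyperbolic 3-space of sectional curvature `-1`. -/
def H3 : Set R31 := {x | lor x x = -1 ∧ 0 < x 0}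

/-- The identification of `ℝ^{3,1}` with the Hermitian `2 × 2` matrices. -/
def herm (x : R31) : Mat2 :=
  !![((x 0 + x 3 : ℝ) : ℂ), (x 1 : ℂ) + I * (x 2 : ℂ);
     (x 1 : ℂ) - I * (x 2 : ℂ), ((x 0 - x 3 : ℝ) : ℂ)]

def sigma1 : Mat2 := !![0, 1; 1, 0]

def sigma2 : Mat2 := !![0, I; -I, 0]

def sigma3 : Mat2 := !![1, 0; 0, -1]

/-! ### Conformal immersions of constant mean curvature and their associated families -/

/-- `f : D → ℍ³` is a smooth conformal immersion with metric `e^{2u} dz dz̄`, unit normal field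
(Gauss map) `N`, constant mean curvature `H` and Hopf differential `Q dz²`. The second fundamental
form is `l dx² + 2 m dx dy + n dy²` with `l = ⟨f_xx, N⟩`, `m = ⟨f_xy, N⟩`, `n = ⟨f_yy, N⟩`. -/
structure IsConformalCMC (D : Set ℂ) (u : ℂ → ℝ) (H : ℝ) (Q : ℂ → ℂ) (f N : ℂ → R31) : Prop where
  smooth_u : ContDiffOn ℝ ∞ u D
  smooth_f : ContDiffOn ℝ ∞ f D
  smooth_N : ContDiffOn ℝ ∞ N D
  mem_H3 : ∀ z ∈ D, f z ∈ H3
  metric_xx : ∀ z ∈ D, lor (dx f z) (dx f z) = Real.exp (2 * u z)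
  metric_yy : ∀ z ∈ D, lor (dy f z) (dy f z) = Real.exp (2 * u z)
  metric_xy : ∀ z ∈ D, lor (dx f z) (dy f z) = 0
  normal_unit : ∀ z ∈ D, lor (N z) (N z) = 1
  normal_f : ∀ z ∈ D, lor (N z) (f z) = 0
  normal_x : ∀ z ∈ D, lor (N z) (dx f z) = 0
  normal_y : ∀ z ∈ D, lor (N z) (dy f z) = 0
  mean_curvature : ∀ z ∈ D,
    (lor (dx (dx f) z) (N z) + lor (dy (dy f) z) (N z)) / 2 = H * Real.exp (2 * u z)
  hopf : ∀ z ∈ D,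
    (1 / 4 : ℂ) * (((lor (dx (dx f) z) (N z) - lor (dy (dy f) z) (N z) : ℝ) : ℂ)
      - 2 * I * ((lor (dx (dy f) z) (N z) : ℝ) : ℂ)) = Q z

/-- The Hopf differential of the member `θ` of the associated family: `Q ↦ θ⁻² Q`. -/
def hopfTheta (Q : ℂ → ℂ) (θ : Circle) (z : ℂ) : ℂ := ((θ : ℂ) ^ 2)⁻¹ * Q z

/-- An associated family: conformal CMC immersions `f θ` with Gauss maps `N θ`, `θ ∈ S¹`, all
with the same metric and the same mean curvature, and with Hopf differentials `θ⁻² Q dz²`. -/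
def IsAssociatedFamily (D : Set ℂ) (u : ℂ → ℝ) (H : ℝ) (Q : ℂ → ℂ)
    (f N : Circle → ℂ → R31) : Prop :=
  ∀ θ : Circle, IsConformalCMC D u H (hopfTheta Q θ) (f θ) (N θ)

/-- `F : D → SL(2, ℂ)` is the moving frame of `f`: under the action `x ↦ F x F*`, the matrices
`σ₀ = 1, σ₁, σ₂, σ₃` are taken to the orthonormal frame `f, e^{-u} f_x, e^{-u} f_y, N`. -/
structure IsMovingFrame (D : Set ℂ) (u : ℂ → ℝ) (f N : ℂ → R31) (F : ℂ → Mat2) : Prop where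
  smooth : SmoothMat D F
  det_eq : ∀ z ∈ D, (F z).det = 1
  frame0 : ∀ z ∈ D, F z * (F z)ᴴ = herm (f z)
  frame1 : ∀ z ∈ D, F z * sigma1 * (F z)ᴴ = herm (Real.exp (-u z) • dx f z)
  frame2 : ∀ z ∈ D, F z * sigma2 * (F z)ᴴ = herm (Real.exp (-u z) • dy f z)
  frame3 : ∀ z ∈ D, F z * sigma3 * (F z)ᴴ = herm (N z)

/-! ### The spectral deformation of the Maurer-Cartan form -/

/-- The `dz`-part of the Maurer-Cartan form with metric factor `u` and Hopf differential `q`,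
where the real number `a` stands for `1 + H`. -/
def laxA (u : ℂ → ℝ) (q : ℂ → ℂ) (a : ℝ) (z : ℂ) : Mat2 :=
  !![(1 / 2) * wirt (fun w => (u w : ℂ)) z, ((Real.exp (u z) * a / 2 : ℝ) : ℂ);
     -((Real.exp (-u z) : ℝ) : ℂ) * q z, -((1 / 2) * wirt (fun w => (u w : ℂ)) z)]

/-- The `dz̄`-part of the Maurer-Cartan form with metric factor `u` and Hopf differential `q`,
where the real number `b` stands for `1 - H`. -/
def laxB (u : ℂ → ℝ) (q : ℂ → ℂ) (b : ℝ) (z : ℂ) : Mat2 :=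
  !![-((1 / 2) * wirtBar (fun w => (u w : ℂ)) z), ((Real.exp (-u z) : ℝ) : ℂ) * conj (q z);
     ((Real.exp (u z) * b / 2 : ℝ) : ℂ), (1 / 2) * wirtBar (fun w => (u w : ℂ)) z]

/-- `A(s, θ)`: the `dz`-part after the `s`-deformation `1 + H ↦ s (1 + H)` and the
`θ`-deformation `Q ↦ θ⁻² Q`. -/
def defA (u : ℂ → ℝ) (H : ℝ) (Q : ℂ → ℂ) (s : ℝ) (θ : Circle) : ℂ → Mat2 :=
  laxA u (hopfTheta Q θ) (s * (1 + H))

/-- `B(s, θ)`: the `dz̄`-part after the `s`-deformation `1 - H ↦ s⁻¹ (1 - H)` and the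
`θ`-deformation `Q ↦ θ⁻² Q`. -/
def defB (u : ℂ → ℝ) (H : ℝ) (Q : ℂ → ℂ) (s : ℝ) (θ : Circle) : ℂ → Mat2 :=
  laxB u (hopfTheta Q θ) (s⁻¹ * (1 - H))

/-- The `z`-independent unitary matrix `G = i (0, θ^{1/2}; θ^{-1/2}, 0)`. The conjugate
`G X G⁻¹` does not depend on the choice of the square root. -/
def gaugeG (θ : Circle) : Mat2 :=
  I • !![0, (θ : ℂ) ^ (1 / 2 : ℂ); (θ : ℂ) ^ (-(1 / 2) : ℂ), 0]

/-- `A^λ = G A(s, θ) G⁻¹`, with `λ = s θ`. -/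
def twA (u : ℂ → ℝ) (H : ℝ) (Q : ℂ → ℂ) (s : ℝ) (θ : Circle) (z : ℂ) : Mat2 :=
  gaugeG θ * defA u H Q s θ z * (gaugeG θ)⁻¹

/-- `B^λ = G B(s, θ) G⁻¹`, with `λ = s θ`. -/
def twB (u : ℂ → ℝ) (H : ℝ) (Q : ℂ → ℂ) (s : ℝ) (θ : Circle) (z : ℂ) : Mat2 :=
  gaugeG θ * defB u H Q s θ z * (gaugeG θ)⁻¹

/-- The Lie algebra `su(2)`: trace-free skew-Hermitian matrices. -/
def su2 : Set Mat2 := {X | Xᴴ = -X ∧ X.trace = 0}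

/-- The 1-form `A dz + B dz̄` takes values in `su(2)` at every point of `D`, on every real
tangent vector `v`. -/
def IsSu2Form (D : Set ℂ) (A B : ℂ → Mat2) : Prop :=
  ∀ z ∈ D, ∀ v : ℂ, v • A z + conj v • B z ∈ su2

/-! ### The twisted loop group of `SU(2)` and harmonic maps into the sphere -/

/-- A continuous function on the circle lies in the Sobolev space `H^p`. -/
def IsHp (p : ℝ) (g : Circle → ℂ) : Prop :=
  Continuous g ∧ Summable fun n : ℤ =>
    (1 + (n : ℝ) ^ 2) ^ p * ‖fourierCoeff (fun x : AddCircle (1 : ℝ) => g x.toCircle) n‖ ^ 2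

/-- The twisted loop group `ΛSU(2)` (of Sobolev class `H^p`): loops `g : S¹ → SU(2)` with
`g (-θ) = σ₃ g(θ) σ₃⁻¹`. -/
def LoopSU2 (p : ℝ) : Set (Circle → Mat2) :=
  {g | (∀ θ, g θ ∈ Matrix.specialUnitaryGroup (Fin 2) ℂ) ∧
    (∀ θ, g (-θ) = sigma3 * g θ * sigma3⁻¹) ∧
    ∀ i j, IsHp p fun θ => g θ i j}

/-- Euclidean 3-space. -/
abbrev E3 : Type := EuclideanSpace ℝ (Fin 3)

/-- The natural projection `SU(2) → SU(2)/U(1) = S²`, `g ↦ g σ₃ g⁻¹`, where a trace-free Hermitian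
matrix `x¹σ₁ + x²σ₂ + x³σ₃` is identified with the vector `(x¹, x², x³)`. -/
def projS2 (g : Mat2) : E3 :=
  !₂[((g * sigma3 * g⁻¹) 0 1).re, ((g * sigma3 * g⁻¹) 0 1).im,
    (((g * sigma3 * g⁻¹) 0 0).re - ((g * sigma3 * g⁻¹) 1 1).re) / 2]

/-- `N : D → S² ⊂ ℝ³` is a harmonic map: it is smooth and its tension field, which is the
component of `ΔN` tangent to the sphere, vanishes. -/
structure IsHarmonicToS2 (D : Set ℂ) (N : ℂ → E3) : Prop where
  smooth : ContDiffOn ℝ ∞ N D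
  mem_sphere : ∀ z ∈ D, N z ∈ Metric.sphere (0 : E3) 1
  tension : ∀ z ∈ D, Δ N z - (inner ℝ (Δ N z) (N z)) • N z = 0

end CMCHyp

end

open Matrix Complex
open scoped ContDiff ComplexConjugate Laplacian

noncomputable section

namespace CMCHyp

open Metric Set

/-! ### Flat connections in a Banach algebra: local existence -/

/-! Differentiating the equations `F P F* = ` (frame vector) and cancelling `F` on the left and `F*`
on the right determines `F⁻¹ dF`: `f_x`, `f_y` fix its Hermitian part, the symmetry of the second
derivatives fixes the diagonal, and the second fundamental form fixes the rest
(`maurerCartan_of_movingFrame`). Since this form comes from a frame it is flat, which amounts to the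
equations of Gauss and Codazzi (`gaussCodazzi_of_associatedFamily`).

The Gauss equation sees the mean curvature only through the product `(1 + H)(1 - H)`, and the
Codazzi equation not at all. Hence the `s`-deformation preserves flatness. Conjugation by `G` turns
`θ` into a spectral parameter: the diagonal is free of it and the off-diagonal entries contain only
`λ` and `λ⁻¹`, so the form is twisted, and it is flat for every complex `λ ≠ 0` (`twX'_sub_twY'`).
It takes values in `su(2)` on `|λ| = 1` when `s (1 + H) = -s⁻¹ (1 - H)`, that is, at `s₀`.

The frame is found for all `λ` at once, by solving `dF = F Ω` in a Banach algebra
(`exists_flat_frame`): locally by ordinary differential equations along rays, globally by simple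
connectedness. The algebra is the closure of the twisted Laurent polynomials on the annulus `1/2 ≤
|λ| ≤ 2`. Its elements satisfy the twist condition, and having room on both sides of the unit circle
makes their Fourier coefficients decay geometrically, so that they lie in every `H^p`
(`loopAlgebra_isHp`). On `|λ| = 1` the frame is unitary because its Maurer-Cartan form is in `su(2)`
and it starts at the identity.

Finally, the Laplacian of `F σ₃ F⁻¹` is `F` conjugating a matrix whose off-diagonal part vanishes by
Codazzi (`twX_twY_tension`). So the Laplacian is a multiple of the map itself, which is harmonicity
into the sphere. -/

theorem exists_ball_taylor_bounds {E G : Type*} [NormedAddCommGroup E] [NormedSpace ℝ E]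
    [NormedAddCommGroup G] [NormedSpace ℝ G] {D : Set E} (hD : IsOpen D) {f : E → G}
    (hf : ContDiffOn ℝ 2 f D) {z₀ : E} (hz₀ : z₀ ∈ D) :
    ∃ M : ℝ, 1 ≤ M ∧ ∃ r : ℝ, 0 < r ∧ ball z₀ r ⊆ D ∧ ∀ x ∈ ball z₀ r,
      ‖f x‖ ≤ M ∧ ‖fderiv ℝ f x‖ ≤ M ∧ ∀ y ∈ ball z₀ r,
        ‖f y - f x‖ ≤ M * ‖y - x‖ ∧ ‖f y - f x - fderiv ℝ f x (y - x)‖ ≤ M * ‖y - x‖ ^ 2 := by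
  have hat : ContDiffAt ℝ 2 f z₀ := hf.contDiffAt (hD.mem_nhds hz₀)
  have hat1 : ContDiffAt ℝ 1 (fderiv ℝ f) z₀ := hat.fderiv_right (by norm_num)
  -- A `C²` map has a locally Lipschitz derivative; this alone gives the quadratic Taylor remainder
  -- below.
  obtain ⟨K, t, ht, hK⟩ := hat1.exists_lipschitzOnWith
  have h1 : ∀ᶠ x in nhds z₀, ‖f x‖ < ‖f z₀‖ + 1 :=
    hat.continuousAt.norm.eventually (gt_mem_nhds (lt_add_one _))
  have h2 : ∀ᶠ x in nhds z₀, ‖fderiv ℝ f x‖ < ‖fderiv ℝ f z₀‖ + 1 :=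
    hat1.continuousAt.norm.eventually (gt_mem_nhds (lt_add_one _))
  obtain ⟨r, hr, hball⟩ := Metric.eventually_nhds_iff_ball.1
    ((h1.and h2).and ((Filter.eventually_mem_set.2 (hD.mem_nhds hz₀)).and
      (Filter.eventually_mem_set.2 ht)))
  refine ⟨‖f z₀‖ + ‖fderiv ℝ f z₀‖ + K + 1, ?_, r, hr, fun x hx => (hball x hx).2.1, ?_⟩
  · have := norm_nonneg (f z₀); have := norm_nonneg (fderiv ℝ f z₀); have := K.2
    simp only [NNReal.val_eq_coe] at this
    linarith
  have p1 := norm_nonneg (f z₀)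
  have p2 := norm_nonneg (fderiv ℝ f z₀)
  have p3 : (0 : ℝ) ≤ K := K.2
  have hdiff : ∀ x ∈ ball z₀ r, DifferentiableAt ℝ f x := fun x hx =>
    ((hf.differentiableOn (by norm_num)) x (hball x hx).2.1).differentiableAt
      (hD.mem_nhds (hball x hx).2.1)
  intro x hx
  obtain ⟨⟨a1, a2⟩, -, a4⟩ := hball x hx
  refine ⟨by linarith, by linarith, fun y hy => ⟨?_, ?_⟩⟩
  · refine (convex_ball z₀ r).norm_image_sub_le_of_norm_fderiv_le (fun w hw => hdiff w hw) ?_ hx hy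
    intro w hw
    have := (hball w hw).1.2
    linarith
  · have hseg : segment ℝ x y ⊆ ball z₀ r := (convex_ball z₀ r).segment_subset hx hy
    -- Mean value inequality against the fixed linear map `fderiv ℝ f x`, from which the derivative
    -- deviates by at most `K * ‖y - x‖` on the segment.
    have key := (convex_segment x y).norm_image_sub_le_of_norm_hasFDerivWithin_le'
      (f := f) (f' := fderiv ℝ f) (φ := fderiv ℝ f x) (C := K * ‖y - x‖)
      (fun w hw => (hdiff w (hseg hw)).hasFDerivAt.hasFDerivWithinAt) ?_
      (left_mem_segment ℝ x y) (right_mem_segment ℝ x y)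
    · refine key.trans ?_
      have : 0 ≤ ‖y - x‖ ^ 2 := by positivity
      nlinarith
    · intro w hw
      refine (hK.norm_sub_le (hball w (hseg hw)).2.2 a4).trans ?_
      gcongr
      obtain ⟨s, hs, rfl⟩ := (segment_eq_image' ℝ x y ▸ hw)
      simp only [add_sub_cancel_left, norm_smul, Real.norm_eq_abs, abs_of_nonneg hs.1]
      exact mul_le_of_le_one_left (norm_nonneg _) hs.2

/-- A connection form `Ω` with values in an associative algebra is flat if `dΩ + Ω ∧ Ω = 0`. -/
def IsFlatOn {E A : Type*} [NormedAddCommGroup E] [NormedSpace ℝ E] [NormedRing A]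
    [NormedAlgebra ℝ A] (Ω : E → E →L[ℝ] A) (D : Set E) : Prop :=
  ∀ z ∈ D, ∀ a b, fderiv ℝ Ω z a b - fderiv ℝ Ω z b a + (Ω z a * Ω z b - Ω z b * Ω z a) = 0

/-- On the unit ball about `1` the field `x * c t` has norm at most `(‖1‖ + 1) * k ≤ 1`, so
Picard-Lindelöf reaches time `1` without leaving the ball. The norm of `1` is kept because it need
not be `1`. -/
theorem exists_ray_solution {A : Type*} [NormedRing A] [NormedAlgebra ℝ A] [CompleteSpace A] {c : ℝ → A} {k : ℝ} (hk : 0 ≤ k)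
    (hc : ContinuousOn c (Icc 0 1)) (hck : ∀ t ∈ Icc (0 : ℝ) 1, ‖c t‖ ≤ k)
    (hk1 : (‖(1 : A)‖ + 1) * k ≤ 1) :
    ∃ γ : ℝ → A, γ 0 = 1 ∧ ∀ t ∈ Icc (0 : ℝ) 1, HasDerivWithinAt γ (γ t * c t) (Icc 0 1) t := by
  have hp : IsPicardLindelof (fun t x => x * c t) (tmin := 0) (tmax := 1)
      ⟨0, by simp⟩ (1 : A) 1 0 1 ⟨k, hk⟩ := by
    constructor
    · intro t ht
      refine LipschitzOnWith.of_dist_le_mul fun x _ y _ => ?_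
      rw [dist_eq_norm, dist_eq_norm, ← sub_mul]
      refine (norm_mul_le _ _).trans ?_
      rw [mul_comm]
      exact mul_le_mul_of_nonneg_right (hck t ht) (norm_nonneg _)
    · intro x _
      exact continuousOn_const.mul hc
    · intro t ht x hx
      have h1 : ‖x‖ ≤ ‖(1 : A)‖ + 1 := by
        have := norm_le_norm_add_norm_sub' x 1
        rw [mem_closedBall, dist_eq_norm] at hx
        have h2 : ‖x - 1‖ ≤ 1 := by simpa using hx
        linarith
      refine (norm_mul_le _ _).trans (le_trans ?_ (by simpa using hk1))
      exact mul_le_mul h1 (hck t ht) (norm_nonneg _) (by positivity)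
    · simp
  obtain ⟨γ, h0, h⟩ := hp.exists_eq_forall_mem_Icc_hasDerivWithinAt₀
  exact ⟨γ, h0, h⟩

end CMCHyp
end

noncomputable section

namespace CMCHyp

open Metric Set

/-- If `e' = e c + R` on `[0, 1]` with `‖c‖ ≤ 1`, `‖R‖ ≤ ε` and `e 0 = 0`, then `‖e 1‖ ≤ 2 ε`. -/
theorem norm_le_of_hasDerivWithinAt_mul_add {A : Type*} [NormedRing A] [NormedAlgebra ℝ A]
    {e c R : ℝ → A} {ε : ℝ}
    (he : ∀ t ∈ Icc (0 : ℝ) 1, HasDerivWithinAt e (e t * c t + R t) (Icc 0 1) t)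
    (h0 : e 0 = 0) (hc : ∀ t ∈ Icc (0 : ℝ) 1, ‖c t‖ ≤ 1)
    (hR : ∀ t ∈ Icc (0 : ℝ) 1, ‖R t‖ ≤ ε) : ‖e 1‖ ≤ 2 * ε := by
  have hε : 0 ≤ ε := (norm_nonneg _).trans (hR 0 (by simp))
  have key := norm_le_gronwallBound_of_norm_deriv_right_le (f := e)
    (f' := fun t => e t * c t + R t) (δ := 0) (K := 1) (ε := ε) (a := 0) (b := 1)
    (fun t ht => (he t ht).continuousWithinAt)
    (fun t ht => (he t (Ico_subset_Icc_self ht)).mono_of_mem_nhdsWithin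
      (Icc_mem_nhdsGE_of_mem ht))
    (by simp [h0]) ?_ 1 (by simp)
  · rw [gronwallBound_of_K_ne_0 one_ne_zero] at key
    have h3 : Real.exp 1 < 3 := Real.exp_one_lt_d9.trans (by norm_num)
    have : ε * (Real.exp 1 - 1) ≤ ε * 2 := by gcongr; linarith
    simp only [sub_zero, mul_one, div_one, zero_mul, zero_add] at key
    linarith
  · intro t ht
    have ht' := Ico_subset_Icc_self ht
    refine (norm_add_le _ _).trans (add_le_add ?_ (hR t ht'))
    refine (norm_mul_le _ _).trans ?_
    rw [mul_comm]
    exact mul_le_mul_of_nonneg_right (hc t ht') (norm_nonneg _)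

/-- `F z` is the value at time `1` of the solution transported along the ray from `z₀` to `z`.
Flatness makes this radial solution satisfy `dF = F Ω` in all directions. -/
theorem exists_local_flat_frame {E A : Type*} [NormedAddCommGroup E] [NormedSpace ℝ E]
    [NormedRing A] [NormedAlgebra ℝ A] [CompleteSpace A] {D : Set E} (hD : IsOpen D)
    {Ω : E → E →L[ℝ] A} (hΩ : ContDiffOn ℝ 2 Ω D) (hflat : IsFlatOn Ω D) {z₀ : E}
    (hz₀ : z₀ ∈ D) :
    ∃ r : ℝ, 0 < r ∧ ball z₀ r ⊆ D ∧ ∃ F : E → A,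
      (∀ z ∈ ball z₀ r, HasFDerivAt F (F z • Ω z) z) ∧ ∀ z ∈ ball z₀ r, IsUnit (F z) := by
  obtain ⟨M, hM, r₀, hr₀, hsub, hb⟩ := exists_ball_taylor_bounds hD hΩ hz₀
  have hM0 : 0 < M := by linarith
  have hN : 0 < ‖(1 : A)‖ + 1 := by positivity
  -- `r ≤ 1` bounds the vectors `z + h - z₀` in the error estimate; the last inequality is the
  -- smallness condition of `exists_ray_solution`.
  obtain ⟨r, hr, hr0, hr1, hrM⟩ : ∃ r : ℝ, 0 < r ∧ r ≤ r₀ ∧ r ≤ 1 ∧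
      (‖(1 : A)‖ + 1) * (M * r) ≤ 1 := by
    refine ⟨min (min r₀ 1) (1 / ((‖(1 : A)‖ + 1) * M)), by positivity,
      (min_le_left _ _).trans (min_le_left _ _), (min_le_left _ _).trans (min_le_right _ _), ?_⟩
    calc (‖(1 : A)‖ + 1) * (M * _) ≤ (‖(1 : A)‖ + 1) * (M * (1 / ((‖(1 : A)‖ + 1) * M))) := by
          gcongr; exact min_le_right _ _
      _ = 1 := by field_simp
  have hMr : M * r ≤ 1 := by
    have : 0 ≤ ‖(1 : A)‖ := norm_nonneg _
    have : 0 ≤ M * r := by positivity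
    nlinarith
  replace hsub : ball z₀ r ⊆ D := (ball_subset_ball hr0).trans hsub
  replace hb : ∀ x ∈ ball z₀ r, ‖Ω x‖ ≤ M ∧ ‖fderiv ℝ Ω x‖ ≤ M ∧ ∀ y ∈ ball z₀ r,
      ‖Ω y - Ω x‖ ≤ M * ‖y - x‖ ∧ ‖Ω y - Ω x - fderiv ℝ Ω x (y - x)‖ ≤ M * ‖y - x‖ ^ 2 :=
    fun x hx => ⟨(hb x (ball_subset_ball hr0 hx)).1, (hb x (ball_subset_ball hr0 hx)).2.1,
      fun y hy => (hb x (ball_subset_ball hr0 hx)).2.2 y (ball_subset_ball hr0 hy)⟩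
  -- the ray from `z₀` to `z`
  let ρ : E → ℝ → E := fun z t => z₀ + t • (z - z₀)
  have hρ : ∀ z ∈ ball z₀ r, ∀ t ∈ Icc (0 : ℝ) 1, ρ z t ∈ ball z₀ r := by
    intro z hz t ht
    rw [mem_ball_iff_norm] at hz ⊢
    simp only [ρ, add_sub_cancel_left, norm_smul, Real.norm_eq_abs, abs_of_nonneg ht.1]
    exact (mul_le_of_le_one_left (norm_nonneg _) ht.2).trans_lt hz
  have hdiff : ∀ x ∈ ball z₀ r, HasFDerivAt Ω (fderiv ℝ Ω x) x := fun x hx =>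
    (((hΩ.differentiableOn (by norm_num)) x (hsub hx)).differentiableAt
      (hD.mem_nhds (hsub hx))).hasFDerivAt
  have hρd : ∀ z t, HasDerivAt (ρ z) (z - z₀) t := by
    intro z t
    exact (((hasDerivAt_id t).smul_const (z - z₀)).const_add z₀).congr_deriv (one_smul _ _)
  have hΩρ : ∀ z ∈ ball z₀ r, ∀ t ∈ Icc (0 : ℝ) 1,
      HasDerivAt (fun t => Ω (ρ z t)) (fderiv ℝ Ω (ρ z t) (z - z₀)) t := fun z hz t ht =>
    (hdiff _ (hρ z hz t ht)).comp_hasDerivAt t (hρd z t)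
  have hbz : ∀ z ∈ ball z₀ r, ∀ t ∈ Icc (0 : ℝ) 1, ‖Ω (ρ z t) (z - z₀)‖ ≤ M * r := by
    intro z hz t ht
    refine (ContinuousLinearMap.le_opNorm _ _).trans ?_
    exact mul_le_mul (hb _ (hρ z hz t ht)).1 (mem_ball_iff_norm.1 hz).le (norm_nonneg _) hM0.le
  have hγ : ∀ z, ∃ γ : ℝ → A, z ∈ ball z₀ r → γ 0 = 1 ∧ ∀ t ∈ Icc (0 : ℝ) 1,
      HasDerivWithinAt γ (γ t * Ω (ρ z t) (z - z₀)) (Icc 0 1) t := by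
    intro z
    by_cases hz : z ∈ ball z₀ r
    · obtain ⟨γ, h⟩ := exists_ray_solution (c := fun t => Ω (ρ z t) (z - z₀)) (k := M * r)
        (by positivity) (fun t ht =>
          ((hΩρ z hz t ht).continuousAt.clm_apply continuousAt_const).continuousWithinAt)
        (hbz z hz) hrM
      exact ⟨γ, fun _ => h⟩
    · exact ⟨0, fun h => absurd h hz⟩
  choose γ hγ using hγ
  have hderiv : ∀ z ∈ ball z₀ r, HasFDerivAt (fun z => γ z 1) (γ z 1 • Ω z) z := by
    intro z hz
    obtain ⟨g0, g⟩ := hγ z hz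
    obtain ⟨C, hC⟩ := isCompact_Icc.exists_bound_of_continuousOn
      (fun t ht => (g t ht).continuousWithinAt : ContinuousOn (γ z) (Icc 0 1))
    have hC0 : 0 ≤ C := (norm_nonneg _).trans (hC 0 (by simp))
    have main : ∀ h, z + h ∈ ball z₀ r →
        ‖γ (z + h) 1 - γ z 1 - (γ z 1 • Ω z) h‖ ≤ 2 * (C * ((2 * M + 2 * M ^ 2) * ‖h‖ ^ 2)) := by
      intro h hh
      obtain ⟨g0', g'⟩ := hγ (z + h) hh
      have hρh : ∀ t, ρ (z + h) t - ρ z t = t • h := by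
        intro t; simp only [ρ, smul_sub, smul_add]; abel
      have hth : ∀ t ∈ Icc (0 : ℝ) 1, ‖t • h‖ ≤ ‖h‖ := by
        intro t ht
        rw [norm_smul, Real.norm_eq_abs, abs_of_nonneg ht.1]
        exact mul_le_of_le_one_left (norm_nonneg _) ht.2
      -- `e` is the error of the expected first-order expansion at the point of the ray at time `t`.
      -- Flatness exchanges the two arguments of `fderiv ℝ Ω` and cancels the terms linear in `h`,
      -- leaving `e' = e * c + R` with `R` quadratic in `h`.
      have key := norm_le_of_hasDerivWithinAt_mul_add
        (e := fun t => γ (z + h) t - γ z t - γ z t * Ω (ρ z t) (t • h))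
        (c := fun t => Ω (ρ (z + h) t) (z + h - z₀))
        (R := fun t => γ z t * ((Ω (ρ (z + h) t) - Ω (ρ z t)
            - fderiv ℝ Ω (ρ z t) (t • h)) (z + h - z₀) + fderiv ℝ Ω (ρ z t) (t • h) h
          + Ω (ρ z t) (t • h) * ((Ω (ρ (z + h) t) - Ω (ρ z t)) (z + h - z₀) + Ω (ρ z t) h)))
        (ε := C * ((2 * M + 2 * M ^ 2) * ‖h‖ ^ 2)) ?_ ?_ ?_ ?_
      · have e1 : ρ z 1 = z := by simp [ρ]
        simpa [e1] using key
      · intro t ht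
        have d1 : HasDerivWithinAt (fun t : ℝ => t • h) ((1 : ℝ) • h) (Icc 0 1) t :=
          (hasDerivWithinAt_id t _).smul_const h
        have d2 := ((hΩρ z hz t ht).hasDerivWithinAt (s := Icc 0 1)).clm_apply d1
        have d3 := ((g' t ht).sub (g t ht)).sub ((g t ht).mul d2)
        refine d3.congr_deriv ?_
        have fl := hflat (ρ z t) (hsub (hρ z hz t ht)) (z - z₀) (t • h)
        have fl' : fderiv ℝ Ω (ρ z t) (z - z₀) (t • h) = fderiv ℝ Ω (ρ z t) (t • h) (z - z₀)
            - (Ω (ρ z t) (z - z₀) * Ω (ρ z t) (t • h)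
              - Ω (ρ z t) (t • h) * Ω (ρ z t) (z - z₀)) := by
          rw [← sub_eq_zero, ← fl]; abel
        have hs : z + h - z₀ = (z - z₀) + h := by abel
        rw [fl', hs]
        simp only [one_smul, _root_.sub_apply, map_add]
        noncomm_ring
      · simp [g0, g0']
      · intro t ht
        exact (hbz _ hh t ht).trans hMr
      · intro t ht
        have b1 := hb _ (hρ z hz t ht)
        have b2 := b1.2.2 _ (hρ _ hh t ht)
        rw [hρh] at b2
        have n1 : ‖z + h - z₀‖ ≤ 1 := (mem_ball_iff_norm.1 hh).le.trans hr1
        have n0 := norm_nonneg h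
        have q1 : ‖Ω (ρ (z + h) t) - Ω (ρ z t)‖ ≤ M * ‖h‖ :=
          b2.1.trans (by gcongr; exact hth t ht)
        have q2 : ‖Ω (ρ (z + h) t) - Ω (ρ z t) - fderiv ℝ Ω (ρ z t) (t • h)‖ ≤ M * ‖h‖ ^ 2 :=
          b2.2.trans (by gcongr; exact hth t ht)
        have q3 : ‖(Ω (ρ (z + h) t) - Ω (ρ z t) - fderiv ℝ Ω (ρ z t) (t • h)) (z + h - z₀)‖
            ≤ M * ‖h‖ ^ 2 * 1 := ContinuousLinearMap.le_of_opNorm_le_of_le _ q2 n1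
        have q4 : ‖fderiv ℝ Ω (ρ z t) (t • h) h‖ ≤ M * ‖h‖ * ‖h‖ :=
          ContinuousLinearMap.le_of_opNorm_le_of_le _
            (ContinuousLinearMap.le_of_opNorm_le_of_le _ b1.2.1 (hth t ht)) le_rfl
        have q5 : ‖Ω (ρ z t) (t • h)‖ ≤ M * ‖h‖ :=
          ContinuousLinearMap.le_of_opNorm_le_of_le _ b1.1 (hth t ht)
        have q6 : ‖(Ω (ρ (z + h) t) - Ω (ρ z t)) (z + h - z₀)‖ ≤ M * ‖h‖ * 1 :=
          ContinuousLinearMap.le_of_opNorm_le_of_le _ q1 n1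
        have q7 : ‖Ω (ρ z t) h‖ ≤ M * ‖h‖ :=
          ContinuousLinearMap.le_of_opNorm_le_of_le _ b1.1 le_rfl
        have q8 := norm_mul_le_of_le q5 (norm_add_le_of_le q6 q7)
        have q9 := norm_mul_le_of_le (hC t ht) (norm_add_le_of_le (norm_add_le_of_le q3 q4) q8)
        refine q9.trans (le_of_eq ?_)
        ring
    rw [hasFDerivAt_iff_isLittleO_nhds_zero]
    refine (Asymptotics.IsBigO.of_bound (2 * (C * (2 * M + 2 * M ^ 2))) ?_).trans_isLittleO
      (Asymptotics.isLittleO_norm_pow_id one_lt_two)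
    have hev : ∀ᶠ h in nhds (0 : E), z + h ∈ ball z₀ r := by
      have : ContinuousAt (fun h : E => z + h) 0 := by fun_prop
      exact this.eventually_mem (isOpen_ball.mem_nhds (by simpa using hz))
    filter_upwards [hev] with h hh
    refine (main h hh).trans (le_of_eq ?_)
    rw [Real.norm_of_nonneg (by positivity)]
    ring
  have hz₀r : z₀ ∈ ball z₀ r := mem_ball_self hr
  -- The ray to `z₀` is constant, so its solution stays at `1`; invertibility near `z₀` then follows
  -- because the units form a neighbourhood of `1`.
  have hone : γ z₀ 1 = 1 := by
    obtain ⟨g0, g⟩ := hγ z₀ hz₀r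
    rw [← g0]
    refine constant_of_has_deriv_right_zero (f := γ z₀) (a := 0) (b := 1)
      (fun t ht => (g t ht).continuousWithinAt) (fun t ht => ?_) 1 (by simp)
    have := (g t (Ico_subset_Icc_self ht)).mono_of_mem_nhdsWithin (Icc_mem_nhdsGE_of_mem ht)
    simpa using this
  have hunit : ∀ᶠ z in nhds z₀, IsUnit (γ z 1) := by
    refine (hderiv z₀ hz₀r).continuousAt.eventually ?_
    simp only [hone]
    exact Units.nhds 1
  obtain ⟨r', hr', hball⟩ := Metric.eventually_nhds_iff_ball.1 hunit
  refine ⟨min r r', lt_min hr hr', (ball_subset_ball (min_le_left _ _)).trans hsub,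
    fun z => γ z 1, fun z hz => hderiv z (ball_subset_ball (min_le_left _ _) hz),
    fun z hz => hball z (ball_subset_ball (min_le_right _ _) hz)⟩

end CMCHyp
end

noncomputable section

namespace CMCHyp

open Metric Set

/-! ### Flat connections in a Banach algebra: global existence -/

/-- A locally constant cocycle on a simply connected space is a coboundary: it admits a
locally constant family `v` of values in the charts, with a prescribed value at one point. -/
theorem exists_global_section_of_locally_constant_cocycle {B ι A : Type*} [TopologicalSpace B]
    [SimplyConnectedSpace B] [LocallyPathConnectedSpace B] (U : ι → Set B)
    (hU : ∀ i, IsOpen (U i)) (idx : B → ι) (hidx : ∀ x, x ∈ U (idx x)) (c : ι → ι → B → A → A)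
    (hself : ∀ i, ∀ x ∈ U i, ∀ a, c i i x a = a)
    (hcomp : ∀ i j k, ∀ x ∈ U i ∩ U j ∩ U k, ∀ a, c j k x (c i j x a) = c i k x a)
    (hconst : ∀ i j, ∀ x ∈ U i ∩ U j, ∀ y ∈ U i ∩ U j, c i j x = c i j y) (b₀ : B) (a₀ : A) :
    ∃ v : ι → B → A, (∀ i j, ∀ x ∈ U i ∩ U j, v j x = c i j x (v i x)) ∧
      (∀ i, ∀ x ∈ U i, ∀ᶠ y in nhds x, v i y = v i x) ∧ v (idx b₀) b₀ = a₀ := by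
  -- With discrete fibre, locally constant transition maps are continuous, and the bundle they glue
  -- is a covering space.
  let : TopologicalSpace A := ⊥
  have : DiscreteTopology A := ⟨rfl⟩
  let Z : FiberBundleCore ι B A :=
    { baseSet := U
      isOpen_baseSet := hU
      indexAt := idx
      mem_baseSet_at := hidx
      coordChange := c
      coordChange_self := hself
      continuousOn_coordChange := by
        rintro i j ⟨x, a⟩ ⟨hx, -⟩
        have h1 : ContinuousWithinAt (fun p : B × A => c i j x p.2) ((U i ∩ U j) ×ˢ univ) (x, a) :=
          (continuous_of_discreteTopology.comp continuous_snd).continuousWithinAt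
        refine h1.congr (fun p hp => ?_) rfl
        rw [hconst i j p.1 hp.1 x hx]
      coordChange_comp := hcomp }
  have hcov : IsCoveringMap Z.proj := FiberBundle.isCoveringMap (F := A) (E := Z.Fiber)
  -- The identity of a simply connected base lifts through the covering, with prescribed value over
  -- `b₀`; the lift is the global section.
  obtain ⟨s, ⟨hs0, hs⟩, -⟩ := hcov.existsUnique_continuousMap_lifts (ContinuousMap.id B) b₀
    (⟨b₀, a₀⟩ : Z.TotalSpace) rfl
  have hs' : ∀ x, (s x).proj = x := fun x => congrFun hs x
  refine ⟨fun i x => (Z.localTriv i (s x)).2, ?_, ?_, ?_⟩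
  · intro i j x hx
    simp only [FiberBundleCore.localTriv_apply, hs']
    exact (hcomp (idx x) i j x ⟨⟨hidx x, hx.1⟩, hx.2⟩ _).symm
  · intro i x hx
    have h1 : ContinuousAt (fun y => (Z.localTriv i (s y)).2) x := by
      refine continuous_snd.continuousAt.comp (ContinuousAt.comp (f := s) ?_ s.continuous.continuousAt)
      refine (Z.localTriv i).continuousOn_toFun.continuousAt ((Z.localTriv i).open_source.mem_nhds ?_)
      rw [FiberBundleCore.mem_localTriv_source]
      change (s x).proj ∈ U i
      rwa [hs' x]
    exact h1.eventually_mem ((isOpen_discrete {(Z.localTriv i (s x)).2}).mem_nhds rfl)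
  · simp only [FiberBundleCore.localTriv_apply, hs0]
    exact hself _ _ (hidx _) _

/-- The derivative of `F G⁻¹` is `F κ G⁻¹ - F G⁻¹ (G κ) G⁻¹ = 0`: two frames of the same form differ
by a locally constant left factor. -/
theorem hasFDerivAt_mul_ringInverse_of_frames {E A : Type*} [NormedAddCommGroup E]
    [NormedSpace ℝ E] [NormedRing A] [NormedAlgebra ℝ A] [CompleteSpace A] {F G : E → A}
    {κ : E →L[ℝ] A} {z : E} (hF : HasFDerivAt (𝕜 := ℝ) F (F z • κ) z)
    (hG : HasFDerivAt (𝕜 := ℝ) G (G z • κ) z)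
    (hu : IsUnit (G z)) : HasFDerivAt (𝕜 := ℝ) (fun w => F w * Ring.inverse (G w)) 0 z := by
  obtain ⟨g, hg⟩ := hu
  have h1 : HasFDerivAt Ring.inverse _ (G z) := hg ▸ hasFDerivAt_ringInverse (𝕜 := ℝ) g
  have h2 := hF.mul' (h1.comp z hG)
  refine h2.congr_fderiv ?_
  ext v
  simp [← hg, mul_assoc]

/-- Local frames `Φ i` have constant transition factors `Φ i (Φ j)⁻¹` on overlaps of balls, which
are convex and hence connected. Trivialising this cocycle gives locally constant `v i` with `v i Φ i
= v j Φ j`, and these products glue. -/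
theorem exists_flat_frame {E A : Type*} [NormedAddCommGroup E] [NormedSpace ℝ E]
    [NormedRing A] [NormedAlgebra ℝ A] [CompleteSpace A] {D : Set E} (hD : IsOpen D)
    (hDs : IsSimplyConnected D) {Ω : E → E →L[ℝ] A} (hΩ : ContDiffOn ℝ 2 Ω D)
    (hflat : IsFlatOn Ω D) {z₀ : E} (hz₀ : z₀ ∈ D) :
    ∃ F : E → A, F z₀ = 1 ∧ ∀ z ∈ D, HasFDerivAt F (F z • Ω z) z := by
  have : SimplyConnectedSpace D := hDs
  have : LocallyPathConnectedSpace D := hD.locallyPathConnectedSpace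
  choose r hr hrD Φ hΦ hΦu using fun x : D => exists_local_flat_frame hD hΩ hflat x.2
  have hconst : ∀ i j : D, ∀ x ∈ ball (i : E) (r i) ∩ ball (j : E) (r j),
      ∀ y ∈ ball (i : E) (r i) ∩ ball (j : E) (r j),
      Φ i x * Ring.inverse (Φ j x) = Φ i y * Ring.inverse (Φ j y) := by
    intro i j x hx y hy
    have hd : ∀ z ∈ ball (i : E) (r i) ∩ ball (j : E) (r j),
        HasFDerivAt (fun w => Φ i w * Ring.inverse (Φ j w)) (0 : E →L[ℝ] A) z := fun z hz =>
      hasFDerivAt_mul_ringInverse_of_frames (hΦ i z hz.1) (hΦ j z hz.2) (hΦu j z hz.2)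
    exact (isOpen_ball.inter isOpen_ball).is_const_of_fderiv_eq_zero (𝕜 := ℝ)
      ((convex_ball _ _).inter (convex_ball _ _)).isPreconnected
      (fun z hz => (hd z hz).differentiableAt.differentiableWithinAt)
      (fun z hz => (hd z hz).fderiv) hx hy
  obtain ⟨v, hv, hvc, hv0⟩ := exists_global_section_of_locally_constant_cocycle
    (fun i : D => ((↑) : D → E) ⁻¹' ball (i : E) (r i))
    (fun i => isOpen_ball.preimage continuous_subtype_val) id
    (fun x => mem_ball_self (hr x))
    (fun i j x a => a * (Φ i x * Ring.inverse (Φ j x)))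
    (fun i x hx a => by rw [Ring.mul_inverse_cancel _ (hΦu i x hx), mul_one])
    (fun i j k x hx a => by
      have := Ring.inverse_mul_cancel _ (hΦu j x hx.1.2)
      calc a * (Φ i x * Ring.inverse (Φ j x)) * (Φ j x * Ring.inverse (Φ k x))
          = a * (Φ i x * (Ring.inverse (Φ j x) * Φ j x) * Ring.inverse (Φ k x)) := by noncomm_ring
        _ = _ := by rw [this, mul_one])
    (fun i j x hx y hy => by simp only [hconst i j x hx y hy])
    ⟨z₀, hz₀⟩ (Ring.inverse (Φ ⟨z₀, hz₀⟩ z₀))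
  classical
  -- Each point uses the chart centred at itself; `hFeq` shows that every chart containing the point
  -- gives the same value.
  let F : E → A := fun z => if hz : z ∈ D then v ⟨z, hz⟩ ⟨z, hz⟩ * Φ ⟨z, hz⟩ z else 0
  have hFeq : ∀ (i : D) (x : D), (x : E) ∈ ball (i : E) (r i) → F x = v i x * Φ i x := by
    intro i x hx
    have := hv i x x ⟨hx, mem_ball_self (hr x)⟩
    simp only [F, x.2, dite_true, Subtype.coe_eta]
    rw [this, mul_assoc, mul_assoc,
      Ring.inverse_mul_cancel _ (hΦu x x (mem_ball_self (hr x))), mul_one]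
  refine ⟨F, ?_, ?_⟩
  · simp only [id] at hv0
    simp only [F, hz₀, dite_true, hv0]
    exact Ring.inverse_mul_cancel _ (hΦu ⟨z₀, hz₀⟩ _ (mem_ball_self (hr ⟨z₀, hz₀⟩)))
  · intro z hz
    let i : D := ⟨z, hz⟩
    have hev : ∀ᶠ w in nhds z, F w = v i i * Φ i w := by
      have h1 : ∀ᶠ y : D in nhds i, v i y = v i i := hvc i i (mem_ball_self (hr i))
      have h2 : ∀ᶠ w in nhds z, ∃ y : D, (y : E) = w ∧ v i y = v i i := by
        have := hD.isOpenEmbedding_subtypeVal.map_nhds_eq i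
        rw [show z = (i : E) from rfl, ← this, Filter.eventually_map]
        exact h1.mono fun y hy => ⟨y, rfl, hy⟩
      filter_upwards [h2, isOpen_ball.mem_nhds (mem_ball_self (hr i))] with w ⟨y, hyw, hy⟩ hw
      subst hyw
      rw [hFeq i y hw, hy]
    have h3 : HasFDerivAt (fun w => v i i * Φ i w) (v i i • (Φ i z • Ω z)) z :=
      (hΦ i z (mem_ball_self (hr i))).const_mul _
    refine (h3.congr_of_eventuallyEq hev).congr_fderiv ?_
    rw [hev.self_of_nhds, smul_smul]

/-- Bootstrap: if `F` is `C^n`, then so is `F Ω = dF`, hence `F` is `C^{n+1}`. -/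
theorem contDiffOn_of_hasFDerivAt_smul {E A : Type*} [NormedAddCommGroup E] [NormedSpace ℝ E]
    [NormedRing A] [NormedAlgebra ℝ A] {D : Set E} (hD : IsOpen D) {Ω : E → E →L[ℝ] A}
    (hΩ : ContDiffOn ℝ ∞ Ω D) {F : E → A} (hF : ∀ z ∈ D, HasFDerivAt F (F z • Ω z) z) :
    ContDiffOn ℝ ∞ F D := by
  rw [contDiffOn_infty]
  intro n
  induction n with
  | zero =>
    exact contDiffOn_zero.2 fun z hz => (hF z hz).continuousAt.continuousWithinAt
  | succ n ih =>
    rw [Nat.cast_succ, contDiffOn_succ_iff_fderiv_of_isOpen hD]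
    refine ⟨fun z hz => (hF z hz).differentiableAt.differentiableWithinAt, by simp, ?_⟩
    have h1 : ContDiffOn ℝ n (fun z => ((ContinuousLinearMap.compL ℝ E A A)
        (ContinuousLinearMap.mul ℝ A (F z))) (Ω z)) D := by
      refine ContDiffOn.clm_apply ?_ (hΩ.of_le (by exact_mod_cast le_top))
      exact (ContinuousLinearMap.contDiff _).comp_contDiffOn
        ((ContinuousLinearMap.contDiff _).comp_contDiffOn ih)
    refine h1.congr fun z hz => ?_
    rw [(hF z hz).fderiv]
    rfl

end CMCHyp
end

noncomputable section

namespace CMCHyp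

open Set MeasureTheory

/-! ### A Banach algebra of twisted loops that extend to the annulus `1/2 ≤ |λ| ≤ 2` -/

section LoopAlgebra

attribute [local instance] Matrix.linftyOpNormedRing Matrix.linftyOpNormedAlgebra

/-- Polar coordinates on the closed annulus `1/2 ≤ |λ| ≤ 2`. -/
abbrev Annulus : Type := Icc (1 / 2 : ℝ) 2 × Circle

/-- The spectral parameter `λ = r θ`. -/
def spectral (k : Annulus) : ℂ := ((k.1 : ℝ) : ℂ) * (k.2 : ℂ)

/-- The unit circle in the annulus. -/
def unitRadius : Icc (1 / 2 : ℝ) 2 := ⟨1, by norm_num⟩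

theorem spectral_ne_zero (k : Annulus) : spectral k ≠ 0 := by
  have h : (0 : ℝ) < k.1 := lt_of_lt_of_le (by norm_num) k.1.2.1
  exact mul_ne_zero (by exact_mod_cast h.ne') (Circle.coe_ne_zero _)

theorem continuous_spectral : Continuous spectral := by
  exact (Complex.continuous_ofReal.comp (continuous_subtype_val.comp continuous_fst)).mul
    (continuous_induced_dom.comp continuous_snd)

theorem spectral_unitRadius (θ : Circle) : spectral (unitRadius, θ) = θ := by
  simp [spectral, unitRadius]

/-- The loop `λ ↦ λⁿ M`. -/
def loopMonomial (n : ℤ) (M : Mat2) : C(Annulus, Mat2) where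
  toFun k := spectral k ^ n • M
  continuous_toFun := by
    have h : Continuous fun k => spectral k ^ n :=
      continuous_spectral.zpow₀ n fun k => Or.inl (spectral_ne_zero k)
    exact h.smul continuous_const

theorem loopMonomial_apply (n : ℤ) (M : Mat2) (k : Annulus) :
    loopMonomial n M k = spectral k ^ n • M := rfl

theorem loopMonomial_mul (m n : ℤ) (M N : Mat2) :
    loopMonomial m M * loopMonomial n N = loopMonomial (m + n) (M * N) := by
  ext1 k
  simp only [ContinuousMap.mul_apply, loopMonomial_apply, zpow_add₀ (spectral_ne_zero k),
    smul_mul_smul_comm]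

theorem loopMonomial_zero_one : loopMonomial 0 1 = 1 := by
  ext1 k
  simp [loopMonomial_apply]

theorem sigma3_mul_self : sigma3 * sigma3 = 1 := by
  ext i j
  fin_cases i <;> fin_cases j <;> simp [sigma3]

theorem sigma3_inv : sigma3⁻¹ = sigma3 := Matrix.inv_eq_right_inv sigma3_mul_self

/-- The Laurent monomials `λⁿ M` which satisfy the twist condition. -/
def twistedMonomials : Set C(Annulus, Mat2) :=
  {g | ∃ (n : ℤ) (M : Mat2), sigma3 * M * sigma3⁻¹ = (-1 : ℂ) ^ n • M ∧ g = loopMonomial n M}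

/-- The closure of the algebra of twisted Laurent polynomials on the annulus. -/
def loopAlgebra : Subalgebra ℂ C(Annulus, Mat2) :=
  (Algebra.adjoin ℂ twistedMonomials).topologicalClosure

instance : CompleteSpace loopAlgebra :=
  (Subalgebra.isClosed_topologicalClosure _).completeSpace_coe

theorem loopMonomial_mem {n : ℤ} {M : Mat2} (h : sigma3 * M * sigma3⁻¹ = (-1 : ℂ) ^ n • M) :
    loopMonomial n M ∈ loopAlgebra :=
  Subalgebra.le_topologicalClosure _ (Algebra.subset_adjoin ⟨n, M, h, rfl⟩)

/-- Twisted monomials are closed under products, so the algebra they generate is already their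
linear span. Hence no case for products is needed. -/
theorem loopAlgebra_induction {p : C(Annulus, Mat2) → Prop} (hclosed : IsClosed {g | p g})
    (hadd : ∀ f g, p f → p g → p (f + g)) (hsmul : ∀ (c : ℂ) g, p g → p (c • g))
    (hmono : ∀ (n : ℤ) (M : Mat2), sigma3 * M * sigma3⁻¹ = (-1 : ℂ) ^ n • M →
      p (loopMonomial n M)) {g : C(Annulus, Mat2)} (hg : g ∈ loopAlgebra) : p g := by
  have hsub : (Algebra.adjoin ℂ twistedMonomials : Set C(Annulus, Mat2)) ⊆ {g | p g} := by
    intro g hg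
    have hg' : g ∈ Submodule.span ℂ
        (Submonoid.closure twistedMonomials : Set C(Annulus, Mat2)) := by
      rw [← Algebra.adjoin_eq_span]; exact hg
    clear hg
    have hmon : ∀ f ∈ Submonoid.closure twistedMonomials, f ∈ twistedMonomials := by
      intro f hf
      induction hf using Submonoid.closure_induction with
      | mem x hx => exact hx
      | one =>
        refine ⟨0, 1, ?_, loopMonomial_zero_one.symm⟩
        rw [sigma3_inv, mul_one, sigma3_mul_self, zpow_zero, one_smul]
      | mul x y _ _ hx hy =>
        obtain ⟨m, M, hM, rfl⟩ := hx
        obtain ⟨n, N, hN, rfl⟩ := hy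
        refine ⟨m + n, M * N, ?_, loopMonomial_mul m n M N⟩
        rw [zpow_add₀ (by norm_num), ← smul_mul_smul_comm, ← hM, ← hN, sigma3_inv]
        have : sigma3 * M * sigma3 * (sigma3 * N * sigma3)
            = sigma3 * M * (sigma3 * sigma3) * N * sigma3 := by noncomm_ring
        rw [this, sigma3_mul_self, mul_one, ← mul_assoc]
    induction hg' using Submodule.span_induction with
    | mem x hx =>
      obtain ⟨n, M, hM, rfl⟩ := hmon x hx
      exact hmono n M hM
    | zero =>
      have h0 : (0 : ℂ) • loopMonomial 0 1 = 0 := by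
        ext1 k
        simp
      exact h0 ▸ hsmul 0 _ (hmono 0 1 (by
        rw [sigma3_inv, mul_one, sigma3_mul_self, zpow_zero, one_smul]))
    | add x y _ _ hx hy => exact hadd x y hx hy
    | smul c x _ hx => exact hsmul c x hx
  exact closure_minimal hsub hclosed hg

theorem loopAlgebra_twist {g : C(Annulus, Mat2)} (hg : g ∈ loopAlgebra) (r : Icc (1 / 2 : ℝ) 2)
    (θ : Circle) : g (r, -θ) = sigma3 * g (r, θ) * sigma3⁻¹ := by
  refine loopAlgebra_induction (p := fun g => g (r, -θ) = sigma3 * g (r, θ) * sigma3⁻¹) ?_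
    (fun f g hf hg => ?_) (fun c g hg => ?_) (fun n M hM => ?_) hg
  · exact isClosed_eq (continuous_eval_const _)
      ((continuous_const.mul (continuous_eval_const _)).mul continuous_const)
  · simp only [ContinuousMap.add_apply, hf, hg, mul_add, add_mul]
  · simp only [ContinuousMap.smul_apply, hg, mul_smul_comm, smul_mul_assoc]
  · have : spectral (r, -θ) = (-1) * spectral (r, θ) := by simp [spectral]
    simp only [loopMonomial_apply, mul_smul_comm, smul_mul_assoc, hM, this, mul_zpow, smul_smul]
    rw [mul_comm]

/-- The `n`-th Fourier coefficient as a continuous functional. -/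
def circleCoeff (n : ℤ) : C(AddCircle (1 : ℝ), ℂ) →L[ℂ] ℂ :=
  LinearMap.mkContinuous
    { toFun := fun f => fourierCoeff f n
      map_add' := fun f g => by
        have hf : ∀ f : C(AddCircle (1 : ℝ), ℂ), Integrable f AddCircle.haarAddCircle := fun f =>
          f.continuous.integrable_of_hasCompactSupport
            (HasCompactSupport.of_compactSpace _)
        exact congrFun (fourierCoeff.add (hf f) (hf g)) n
      map_smul' := fun c f => fourierCoeff.const_smul f c n } 1 fun f => by
    refine (norm_integral_le_of_norm_le_const (C := ‖f‖) (Filter.Eventually.of_forall fun x => ?_)).trans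
      (by simp)
    rw [norm_smul]
    rw [fourier_apply, Circle.norm_coe, one_mul]
    exact f.norm_coe_le_norm x

/-- An entry of the restriction of a loop to the circle of radius `r`. -/
def loopSlice (r : Icc (1 / 2 : ℝ) 2) (i j : Fin 2) (g : C(Annulus, Mat2)) :
    C(AddCircle (1 : ℝ), ℂ) where
  toFun x := g (r, x.toCircle) i j
  continuous_toFun := by
    have h : Continuous fun x : AddCircle (1 : ℝ) => g (r, x.toCircle) :=
      g.continuous.comp (continuous_const.prodMk AddCircle.continuous_toCircle)
    exact h.matrix_elem i j

theorem continuous_loopSlice (r : Icc (1 / 2 : ℝ) 2) (i j : Fin 2) :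
    Continuous (loopSlice r i j) := by
  refine ContinuousMap.continuous_of_continuous_uncurry _ ?_
  have h : Continuous fun p : C(Annulus, Mat2) × AddCircle (1 : ℝ) => p.1 (r, p.2.toCircle) :=
    ContinuousEval.continuous_eval.comp (continuous_fst.prodMk
      (continuous_const.prodMk (AddCircle.continuous_toCircle.comp continuous_snd)))
  exact h.matrix_elem i j

/-- This replaces Cauchy's theorem: the relation is evident for `λᵐ M`, and both sides are linear
and continuous in the loop. -/
theorem loopAlgebra_fourierCoeff {g : C(Annulus, Mat2)} (hg : g ∈ loopAlgebra)
    (r : Icc (1 / 2 : ℝ) 2) (i j : Fin 2) (n : ℤ) :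
    circleCoeff n (loopSlice r i j g)
      = ((r : ℝ) : ℂ) ^ n * circleCoeff n (loopSlice unitRadius i j g) := by
  refine loopAlgebra_induction (p := fun g => circleCoeff n (loopSlice r i j g)
      = ((r : ℝ) : ℂ) ^ n * circleCoeff n (loopSlice unitRadius i j g)) ?_
    (fun f g hf hg => ?_) (fun c g hg => ?_) (fun m M hM => ?_) hg
  · exact isClosed_eq ((circleCoeff n).continuous.comp (continuous_loopSlice r i j))
      (continuous_const.mul ((circleCoeff n).continuous.comp (continuous_loopSlice _ i j)))
  · have h : ∀ r, loopSlice r i j (f + g) = loopSlice r i j f + loopSlice r i j g := fun r => rfl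
    rw [h, h, map_add, map_add, hf, hg, mul_add]
  · have h : ∀ r, loopSlice r i j (c • g) = c • loopSlice r i j g := fun r => rfl
    rw [h, h, map_smul, map_smul, hg, smul_eq_mul, smul_eq_mul, mul_left_comm]
  · have h : ∀ r : Icc (1 / 2 : ℝ) 2, loopSlice r i j (loopMonomial m M)
        = ((((r : ℝ) : ℂ) ^ m) * M i j) • fourier m := by
      intro r
      ext x
      simp only [loopSlice, ContinuousMap.coe_mk, loopMonomial_apply, Matrix.smul_apply, spectral,
        smul_eq_mul, ContinuousMap.smul_apply, fourier_apply, AddCircle.toCircle_zsmul,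
        Circle.coe_zpow, mul_zpow]
      ring
    have h2 : circleCoeff n (fourier m) = if n = m then 1 else 0 := by
      have : fourierCoeff (T := 1) (fourier m) n = (Pi.single m 1 : ℤ → ℂ) n := by
        rw [fourierCoeff_fourier]
      rw [← Pi.single_apply]
      exact this
    rw [h, h, map_smul, map_smul, h2]
    split_ifs with hnm
    · simp [hnm, unitRadius]
    · simp

theorem summable_weight_mul_geometric (k : ℕ) (C : ℝ) :
    Summable fun n : ℤ => (1 + (n : ℝ) ^ 2) ^ k * (C * (1 / 2) ^ n.natAbs) ^ 2 := by
  have h : Summable fun n : ℕ => (1 + (n : ℝ) ^ 2) ^ k * (C * (1 / 2) ^ n) ^ 2 := by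
    have h0 : ‖(1 / 4 : ℝ)‖ < 1 := by norm_num
    have h1 : Summable fun n : ℕ => 2 ^ k * C ^ 2 * ((n : ℝ) ^ (2 * k) * (1 / 4 : ℝ) ^ n) :=
      (summable_pow_mul_geometric_of_norm_lt_one (2 * k) h0).mul_left _
    refine h1.of_norm_bounded_eventually_nat ?_
    filter_upwards [Filter.eventually_ge_atTop 1] with n hn
    have hn' : (1 : ℝ) ≤ n := by exact_mod_cast hn
    rw [Real.norm_of_nonneg (by positivity)]
    have e1 : ((1 / 2 : ℝ) ^ n) ^ 2 = (1 / 4) ^ n := by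
      rw [← pow_mul, mul_comm, pow_mul]; norm_num
    calc (1 + (n : ℝ) ^ 2) ^ k * (C * (1 / 2) ^ n) ^ 2
        ≤ (2 * (n : ℝ) ^ 2) ^ k * (C * (1 / 2) ^ n) ^ 2 := by gcongr; nlinarith
      _ = 2 ^ k * C ^ 2 * ((n : ℝ) ^ (2 * k) * (1 / 4) ^ n) := by
          rw [mul_pow, mul_pow, e1, pow_mul]; ring
  refine Summable.of_nat_of_neg ?_ ?_
  · simpa using h
  · simpa using h

theorem loopAlgebra_isHp {g : C(Annulus, Mat2)} (hg : g ∈ loopAlgebra) (p : ℝ) (i j : Fin 2) :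
    IsHp p fun θ => g (unitRadius, θ) i j := by
  have hcont : Continuous fun θ : Circle => g (unitRadius, θ) :=
    g.continuous.comp (continuous_const.prodMk continuous_id)
  refine ⟨hcont.matrix_elem i j, ?_⟩
  -- The slices depend continuously on the radius in a compact interval, so they are uniformly
  -- bounded.
  obtain ⟨C, hC0, hC⟩ : ∃ C : ℝ, 0 ≤ C ∧ ∀ r n, ‖circleCoeff n (loopSlice r i j g)‖ ≤ C := by
    have hK : IsCompact (range fun r => loopSlice r i j g) := by
      refine isCompact_range (ContinuousMap.continuous_of_continuous_uncurry _ ?_)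
      have h : Continuous fun q : Icc (1 / 2 : ℝ) 2 × AddCircle (1 : ℝ) =>
          g (q.1, q.2.toCircle) :=
        g.continuous.comp (continuous_fst.prodMk
          (AddCircle.continuous_toCircle.comp continuous_snd))
      exact h.matrix_elem i j
    obtain ⟨C, hC⟩ := hK.isBounded.exists_norm_le
    refine ⟨C, (norm_nonneg _).trans (hC _ ⟨unitRadius, rfl⟩), fun r n => ?_⟩
    refine ((circleCoeff n).le_opNorm _).trans ?_
    have h1 : ‖circleCoeff n‖ ≤ 1 := LinearMap.mkContinuous_norm_le _ zero_le_one _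
    calc ‖circleCoeff n‖ * ‖loopSlice r i j g‖ ≤ 1 * C :=
          mul_le_mul h1 (hC _ ⟨r, rfl⟩) (norm_nonneg _) zero_le_one
      _ = C := one_mul C
  have hdecay : ∀ n : ℤ, ‖circleCoeff n (loopSlice unitRadius i j g)‖ ≤ C * (1 / 2) ^ n.natAbs := by
    intro n
    -- The radius `2` controls the coefficients with `n ≥ 0`, the radius `1 / 2` those with `n ≤ 0`.
    rcases le_total 0 n with hn | hn
    · have h := loopAlgebra_fourierCoeff hg ⟨2, by norm_num⟩ i j n
      have h2 := hC ⟨2, by norm_num⟩ n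
      lift n to ℕ using hn
      rw [h, norm_mul] at h2
      simp only [zpow_natCast, norm_pow, Complex.norm_real, Real.norm_ofNat] at h2
      rw [Int.natAbs_natCast, one_div, inv_pow, ← div_eq_mul_inv, le_div_iff₀ (by positivity),
        mul_comm]
      exact h2
    · have h := loopAlgebra_fourierCoeff hg ⟨1 / 2, by norm_num⟩ i j n
      have h2 := hC ⟨1 / 2, by norm_num⟩ n
      obtain ⟨m, rfl⟩ := Int.exists_eq_neg_ofNat hn
      rw [h, norm_mul] at h2
      simp only [_root_.zpow_neg, zpow_natCast, norm_inv, norm_pow, Complex.norm_real] at h2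
      rw [Int.natAbs_neg, Int.natAbs_natCast]
      rw [Real.norm_of_nonneg (by norm_num), ← div_eq_inv_mul, div_le_iff₀ (by positivity)] at h2
      exact h2
  -- Geometric decay beats every polynomial weight, so `p` may be raised to a natural number.
  obtain ⟨k, hk⟩ := exists_nat_ge p
  refine (summable_weight_mul_geometric k C).of_nonneg_of_le (fun n => by positivity) fun n => ?_
  refine mul_le_mul ?_ (pow_le_pow_left₀ (norm_nonneg _) (hdecay n) 2) (by positivity)
    (by positivity)
  rw [← Real.rpow_natCast _ k]
  exact Real.rpow_le_rpow_of_exponent_le (le_add_of_nonneg_right (sq_nonneg _)) hk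

end LoopAlgebra

end CMCHyp
end

noncomputable section

namespace CMCHyp

/-! ### Directional derivatives of matrix-valued maps -/

/-- `F'` is the entrywise derivative of `F` at `z` in the direction `v`. -/
def HasDir (F : ℂ → Mat2) (F' : Mat2) (v z : ℂ) : Prop :=
  ∀ i j, HasLineDerivAt ℝ (fun w => F w i j) (F' i j) z v

section HasDir

variable {F G : ℂ → Mat2} {F' G' : Mat2} {v z : ℂ}

theorem HasDir.unique {F'' : Mat2} (h : HasDir F F' v z) (h' : HasDir F F'' v z) : F' = F'' := by
  ext i j
  exact HasDerivAt.unique (h i j) (h' i j)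

theorem hasDir_const (M : Mat2) : HasDir (fun _ => M) 0 v z := fun i j =>
  hasDerivAt_const (0 : ℝ) (M i j)

theorem HasDir.sub (hF : HasDir F F' v z) (hG : HasDir G G' v z) :
    HasDir (fun w => F w - G w) (F' - G') v z := fun i j =>
  HasDerivAt.sub (hF i j) (hG i j)

theorem HasDir.mul (hF : HasDir F F' v z) (hG : HasDir G G' v z) :
    HasDir (fun w => F w * G w) (F' * G z + F z * G') v z := by
  intro i j
  have h0 : z + (0 : ℝ) • v = z := by simp
  have h := (HasDerivAt.fun_mul (hF i 0) (hG 0 j)).fun_add (HasDerivAt.fun_mul (hF i 1) (hG 1 j))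
  simp only [h0] at h
  have e : F' i 0 * G z 0 j + F z i 0 * G' 0 j + (F' i 1 * G z 1 j + F z i 1 * G' 1 j)
      = (F' * G z + F z * G') i j := by
    simp only [Matrix.add_apply, Matrix.mul_apply, Fin.sum_univ_two]; ring
  rw [← e]
  simpa only [HasLineDerivAt, Matrix.mul_apply, Fin.sum_univ_two] using h

theorem HasDir.conjTranspose (hF : HasDir F F' v z) : HasDir (fun w => (F w)ᴴ) F'ᴴ v z :=
  fun i j => HasDerivAt.star (hF j i)

theorem HasDir.smul {φ : ℂ → ℂ} {φ' : ℂ} (hφ : HasLineDerivAt ℝ φ φ' z v) (hF : HasDir F F' v z) :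
    HasDir (fun w => φ w • F w) (φ' • F z + φ z • F') v z := by
  intro i j
  have h0 : z + (0 : ℝ) • v = z := by simp
  have h := HasDerivAt.fun_mul hφ (hF i j)
  simp only [h0] at h
  exact h

theorem HasDir.congr_of_eqOn {D : Set ℂ} (hD : IsOpen D) (hz : z ∈ D) (hF : HasDir F F' v z)
    (h : ∀ w ∈ D, G w = F w) : HasDir G F' v z := fun i j =>
  (hF i j).congr_of_eventuallyEq (Filter.eventuallyEq_of_mem (hD.mem_nhds hz)
    fun w hw => by simp only [h w hw])

end HasDir

/-- The entrywise derivative of a matrix-valued map in the direction `v`. -/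
def dirMat (F : ℂ → Mat2) (v z : ℂ) : Mat2 := Matrix.of fun i j => fderiv ℝ (fun w => F w i j) z v

theorem differentiableAt_of_contDiffOn {E : Type*} [NormedAddCommGroup E] [NormedSpace ℝ E]
    {D : Set ℂ} (hD : IsOpen D) {g : ℂ → E} (hg : ContDiffOn ℝ ∞ g D) {z : ℂ} (hz : z ∈ D) :
    DifferentiableAt ℝ g z :=
  (hg.differentiableOn (by simp) z hz).differentiableAt (hD.mem_nhds hz)

theorem hasLineDerivAt_fderiv {E : Type*} [NormedAddCommGroup E] [NormedSpace ℝ E]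
    {D : Set ℂ} (hD : IsOpen D) {g : ℂ → E} (hg : ContDiffOn ℝ ∞ g D) {z : ℂ} (hz : z ∈ D) (v : ℂ) :
    HasLineDerivAt ℝ g (fderiv ℝ g z v) z v :=
  (differentiableAt_of_contDiffOn hD hg hz).hasFDerivAt.hasLineDerivAt v

theorem contDiffOn_fderiv_apply {E : Type*} [NormedAddCommGroup E] [NormedSpace ℝ E]
    {D : Set ℂ} (hD : IsOpen D) {g : ℂ → E} (hg : ContDiffOn ℝ ∞ g D) (v : ℂ) :
    ContDiffOn ℝ ∞ (fun w => fderiv ℝ g w v) D :=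
  (hg.fderiv_of_isOpen hD (by simp)).clm_apply contDiffOn_const

theorem fderiv_fderiv_comm {E : Type*} [NormedAddCommGroup E] [NormedSpace ℝ E]
    {D : Set ℂ} (hD : IsOpen D) {g : ℂ → E} (hg : ContDiffOn ℝ ∞ g D) {z : ℂ} (hz : z ∈ D)
    (a b : ℂ) :
    fderiv ℝ (fun w => fderiv ℝ g w a) z b = fderiv ℝ (fun w => fderiv ℝ g w b) z a := by
  have hd : DifferentiableAt ℝ (fderiv ℝ g) z :=
    differentiableAt_of_contDiffOn hD (hg.fderiv_of_isOpen hD (by simp)) hz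
  have h : ∀ c, fderiv ℝ (fun w => fderiv ℝ g w c) z = (fderiv ℝ (fderiv ℝ g) z).flip c := by
    intro c
    rw [fderiv_clm_apply hd (differentiableAt_const c)]
    ext; simp
  rw [h, h]
  exact ((hg.contDiffAt (hD.mem_nhds hz)).isSymmSndFDerivAt
    (by simpa using (mod_cast le_top : ((2 : ℕ∞) : WithTop ℕ∞) ≤ ∞))) b a

theorem SmoothMat.hasDir {D : Set ℂ} (hD : IsOpen D) {F : ℂ → Mat2} (hF : SmoothMat D F) {z : ℂ}
    (hz : z ∈ D) (v : ℂ) : HasDir F (dirMat F v z) v z := fun i j =>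
  hasLineDerivAt_fderiv hD (hF i j) hz v

theorem HasDir.dirMat_eq {D : Set ℂ} (hD : IsOpen D) {F : ℂ → Mat2} (hF : SmoothMat D F) {z : ℂ}
    (hz : z ∈ D) {v : ℂ} {F' : Mat2} (h : HasDir F F' v z) : dirMat F v z = F' :=
  (hF.hasDir hD hz v).unique h

theorem SmoothMat.dirMat {D : Set ℂ} (hD : IsOpen D) {F : ℂ → Mat2} (hF : SmoothMat D F) (v : ℂ) :
    SmoothMat D (CMCHyp.dirMat F v) := fun i j => contDiffOn_fderiv_apply hD (hF i j) v

theorem dirMat_dirMat_comm {D : Set ℂ} (hD : IsOpen D) {F : ℂ → Mat2} (hF : SmoothMat D F) {z : ℂ}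
    (hz : z ∈ D) (a b : ℂ) : dirMat (dirMat F a) b z = dirMat (dirMat F b) a z := by
  ext i j
  exact fderiv_fderiv_comm hD (hF i j) hz a b

theorem wirtMat_eq (F : ℂ → Mat2) (z : ℂ) :
    wirtMat F z = (1 / 2 : ℂ) • (dirMat F 1 z - I • dirMat F I z) := rfl

theorem wirtBarMat_eq (F : ℂ → Mat2) (z : ℂ) :
    wirtBarMat F z = (1 / 2 : ℂ) • (dirMat F 1 z + I • dirMat F I z) := rfl

/-! ### The Maurer-Cartan form of the moving frame -/

/-- An entry of `herm` as a real linear map. -/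
def hermEntry (i j : Fin 2) : R31 →L[ℝ] ℂ :=
  LinearMap.toContinuousLinearMap
    { toFun := fun x => herm x i j
      map_add' := fun x y => by
        fin_cases i <;> fin_cases j <;> simp [herm] <;> ring
      map_smul' := fun c x => by
        fin_cases i <;> fin_cases j <;> simp [herm] <;> ring }

theorem hasDir_herm {g : ℂ → R31} {g' : R31} {v z : ℂ} (h : HasLineDerivAt ℝ g g' z v) :
    HasDir (fun w => herm (g w)) (herm g') v z := fun i j =>
  (hermEntry i j).hasFDerivAt.comp_hasDerivAt (0 : ℝ) h

theorem herm_smul (c : ℝ) (x : R31) : herm (c • x) = (c : ℂ) • herm x := by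
  ext i j
  exact ((hermEntry i j).map_smul c x).trans (by simp [hermEntry])

/-- The Lorentzian product is minus the polarisation of the determinant, and `P ↦ F P F*` preserves
determinants when `det F = 1`. So it can be computed from frame components. -/
theorem lor_eq_of_herm_eq {F P R : Mat2} (hF : F.det = 1) {x y : R31}
    (hx : herm x = F * P * Fᴴ) (hy : herm y = F * R * Fᴴ) :
    (lor x y : ℂ) = -(1 / 2) * (P 0 0 * R 1 1 + P 1 1 * R 0 0 - P 0 1 * R 1 0 - P 1 0 * R 0 1) := by
  have h1 : (lor x y : ℂ) = -(1 / 2) * (herm x 0 0 * herm y 1 1 + herm x 1 1 * herm y 0 0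
      - herm x 0 1 * herm y 1 0 - herm x 1 0 * herm y 0 1) := by
    simp [lor, herm]
    linear_combination (x 2 * y 2 : ℂ) * I_sq
  have hd : F 0 0 * F 1 1 - F 0 1 * F 1 0 = 1 := by rw [← Matrix.det_fin_two]; exact hF
  have hd' : star (F 0 0) * star (F 1 1) - star (F 0 1) * star (F 1 0) = 1 := by
    rw [← star_mul', ← star_mul', ← star_sub, hd, star_one]
  rw [h1, hx, hy]
  simp only [Matrix.mul_apply, Fin.sum_univ_two, Matrix.conjTranspose_apply]
  linear_combination (-(1 / 2) * (P 0 0 * R 1 1 + P 1 1 * R 0 0 - P 0 1 * R 1 0 - P 1 0 * R 0 1))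
    * ((star (F 0 0) * star (F 1 1) - star (F 0 1) * star (F 1 0)) * hd + hd')

theorem mul_mul_conjTranspose_cancel {F P R : Mat2} (hF : F.det = 1)
    (h : F * P * Fᴴ = F * R * Fᴴ) : P = R := by
  have hu : IsUnit F := (Matrix.isUnit_iff_isUnit_det F).2 (by simp [hF])
  have hu' : IsUnit Fᴴ := (Matrix.isUnit_iff_isUnit_det _).2 (by simp [Matrix.det_conjTranspose, hF])
  exact hu.mul_left_cancel (hu'.mul_right_cancel h)

/-- The derivative of a vector field with constant frame components up to a factor. -/
theorem herm_fderiv_eq {D : Set ℂ} (hD : IsOpen D) {F : ℂ → Mat2} {z : ℂ} (hz : z ∈ D)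
    {v : ℂ} {W P : Mat2} (hF : HasDir F (F z * W) v z) {g : ℂ → R31} (hg : ContDiffOn ℝ ∞ g D)
    {φ : ℂ → ℂ} {φ' : ℂ} (hφ : HasLineDerivAt ℝ φ φ' z v)
    (h : ∀ w ∈ D, herm (g w) = φ w • (F w * P * (F w)ᴴ)) :
    herm (fderiv ℝ g z v) = F z * (φ' • P + φ z • (W * P + P * Wᴴ)) * (F z)ᴴ := by
  have h1 := (hasDir_herm (hasLineDerivAt_fderiv hD hg hz v))
  have h2 := ((hF.mul (hasDir_const P)).mul hF.conjTranspose).smul hφ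
  rw [h1.unique (h2.congr_of_eqOn hD hz h)]
  simp only [Matrix.conjTranspose_mul, mul_zero, add_zero, mul_add, add_mul, mul_smul_comm,
    smul_mul_assoc, mul_assoc, smul_add]

end CMCHyp
end

noncomputable section

namespace CMCHyp

theorem hasLineDerivAt_ofReal_exp {D : Set ℂ} (hD : IsOpen D) {u : ℂ → ℝ}
    (hu : ContDiffOn ℝ ∞ u D) {z : ℂ} (hz : z ∈ D) (c : ℝ) (v : ℂ) :
    HasLineDerivAt ℝ (fun w => ((Real.exp (c * u w) : ℝ) : ℂ))
      ((Real.exp (c * u z) * (c * fderiv ℝ u z v) : ℝ) : ℂ) z v := by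
  have h0 : z + (0 : ℝ) • v = z := by simp
  have h := (HasDerivAt.const_mul c (hasLineDerivAt_fderiv hD hu hz v)).exp.ofReal_comp
  simp only [h0] at h
  exact h

/-- Jacobi's formula: the derivative of `det F` is `det F` times the trace of `W`. -/
theorem trace_eq_zero_of_det_eq_one {D : Set ℂ} (hD : IsOpen D) {F : ℂ → Mat2} {z v : ℂ}
    (hz : z ∈ D) {W : Mat2} (hF : HasDir F (F z * W) v z) (hdet : ∀ w ∈ D, (F w).det = 1) :
    W 0 0 + W 1 1 = 0 := by
  have h0 : z + (0 : ℝ) • v = z := by simp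
  have h1 := (HasDerivAt.fun_mul (hF 0 0) (hF 1 1)).fun_sub (HasDerivAt.fun_mul (hF 0 1) (hF 1 0))
  have h2 : HasLineDerivAt ℝ (fun w => F w 0 0 * F w 1 1 - F w 0 1 * F w 1 0) 0 z v := by
    have h3 : HasLineDerivAt ℝ (fun _ : ℂ => (1 : ℂ)) 0 z v := hasDerivAt_const (0 : ℝ) (1 : ℂ)
    refine h3.congr_of_eventuallyEq (Filter.eventuallyEq_of_mem (hD.mem_nhds hz) fun w hw => ?_)
    simp only [← hdet w hw, Matrix.det_fin_two]
  have h4 := HasDerivAt.unique h1 h2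
  have hd : F z 0 0 * F z 1 1 - F z 0 1 * F z 1 0 = 1 := by
    rw [← Matrix.det_fin_two]; exact hdet z hz
  simp only [h0, Matrix.mul_apply, Fin.sum_univ_two] at h4
  linear_combination h4 - (W 0 0 + W 1 1) * hd

theorem dirMat_one_eq_of_maurerCartan {D : Set ℂ} {F A B : ℂ → Mat2}
    (h : HasMaurerCartanForm D F A B) {z : ℂ} (hz : z ∈ D) :
    dirMat F 1 z = F z * (A z + B z) := by
  rw [mul_add, ← h.dz_eq z hz, ← h.dzbar_eq z hz, wirtMat_eq, wirtBarMat_eq]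
  ext i j
  simp
  ring

theorem dirMat_I_eq_of_maurerCartan {D : Set ℂ} {F A B : ℂ → Mat2}
    (h : HasMaurerCartanForm D F A B) {z : ℂ} (hz : z ∈ D) :
    dirMat F I z = F z * (I • (A z - B z)) := by
  rw [mul_smul_comm, mul_sub, ← h.dz_eq z hz, ← h.dzbar_eq z hz, wirtMat_eq, wirtBarMat_eq]
  ext i j
  simp
  linear_combination (dirMat F I z i j) * I_sq

theorem dx_ofReal {D : Set ℂ} (hD : IsOpen D) {u : ℂ → ℝ} (hu : ContDiffOn ℝ ∞ u D) {z : ℂ}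
    (hz : z ∈ D) (v : ℂ) : fderiv ℝ (fun w => (u w : ℂ)) z v = (fderiv ℝ u z v : ℝ) := by
  have h := (ofRealCLM.hasFDerivAt).comp z (differentiableAt_of_contDiffOn hD hu hz).hasFDerivAt
  exact congrArg (fun L : ℂ →L[ℝ] ℂ => L v) h.fderiv

/-- The structure equations of an adapted frame determine its Maurer-Cartan form
`X dx + Y dy`. -/
theorem frame_coefficients {X Y : Mat2} {E u1 u2 l m n H : ℝ} {Q : ℂ} (hE : E ≠ 0)
    (tX : X 0 0 + X 1 1 = 0) (tY : Y 0 0 + Y 1 1 = 0)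
    (c1 : (0 : ℂ) • (1 : Mat2) + (1 : ℂ) • (X * 1 + Xᴴ) = (E : ℂ) • sigma1)
    (c2 : (0 : ℂ) • (1 : Mat2) + (1 : ℂ) • (Y * 1 + Yᴴ) = (E : ℂ) • sigma2)
    (c3 : ((E * u1 : ℝ) : ℂ) • sigma2 + (E : ℂ) • (X * sigma2 + sigma2 * Xᴴ)
      = ((E * u2 : ℝ) : ℂ) • sigma1 + (E : ℂ) • (Y * sigma1 + sigma1 * Yᴴ))
    (hl : l = E * ((X 0 1).re - (X 1 0).re)) (hm : m = E * ((X 0 1).im + (X 1 0).im))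
    (hm' : m = E * ((Y 0 1).re - (Y 1 0).re)) (hn : n = E * ((Y 0 1).im + (Y 1 0).im))
    (hmean : (l + n) / 2 = H * (E * E))
    (hq : (1 / 4 : ℂ) * (((l - n : ℝ) : ℂ) - 2 * I * (m : ℂ)) = Q) :
    (1 / 2 : ℂ) • (X - I • Y) =
      !![1 / 2 * (1 / 2 * (u1 - I * u2)), ((E * (1 + H) / 2 : ℝ) : ℂ);
        -((E⁻¹ : ℝ) : ℂ) * Q, -(1 / 2 * (1 / 2 * (u1 - I * u2)))] ∧
    (1 / 2 : ℂ) • (X + I • Y) =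
      !![-(1 / 2 * (1 / 2 * (u1 + I * u2))), ((E⁻¹ : ℝ) : ℂ) * conj Q;
        ((E * (1 - H) / 2 : ℝ) : ℂ), 1 / 2 * (1 / 2 * (u1 + I * u2))] := by
  have ext2 : ∀ {M M' : Mat2}, M = M' → (M 0 0 = M' 0 0 ∧ M 0 1 = M' 0 1) ∧
      (M 1 0 = M' 1 0 ∧ M 1 1 = M' 1 1) := by rintro M _ rfl; simp
  replace c1 := ext2 c1
  replace c2 := ext2 c2
  replace c3 := ext2 c3
  simp [sigma1, sigma2, Matrix.mul_apply, Matrix.vecMul, dotProduct, Fin.sum_univ_two, Complex.ext_iff,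
    -mul_eq_mul_left_iff, -mul_eq_mul_right_iff] at c1 c2 c3 tX tY hq
  -- `c1` and `c2`, coming from `f_x` and `f_y`, give the Hermitian parts of `X` and `Y`. The
  -- equation `c3`, which is `f_xy = f_yx`, gives the imaginary diagonal in terms of `du`, and `l`,
  -- `m`, `n` give the skew off-diagonal parts.
  obtain ⟨⟨c11, c12, c13⟩, -, c14⟩ := c1
  obtain ⟨⟨c21, c22, c23⟩, -, c24⟩ := c2
  obtain ⟨-, ⟨c31, c32⟩, -⟩ := c3
  rw [c24, c21, show (X 0 0).im = -(X 1 1).im by linarith [tX.2]] at c31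
  rw [c14, c11, show (Y 0 0).im = -(Y 1 1).im by linarith [tY.2]] at c32
  rw [show (X 1 0).im = (X 0 1).im by linarith] at hm
  have hx : (X 1 1).im = u2 / 2 := by
    apply mul_left_cancel₀ hE; linarith
  have hy : (Y 1 1).im = -u1 / 2 := by
    apply mul_left_cancel₀ hE; linarith
  have hQr : E⁻¹ * Q.re = ((X 0 1).re - (X 1 0).re - ((Y 0 1).im + (Y 1 0).im)) / 4 := by
    rw [← hq.1]; field_simp; linarith
  have hQi : E⁻¹ * Q.im = -(X 0 1).im := by
    rw [← hq.2]; field_simp; linarith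
  have hm2 : 2 * (X 0 1).im = (Y 0 1).re - (Y 1 0).re := by
    apply mul_left_cancel₀ hE; linarith
  have hHE : 2 * (H * E) = (X 0 1).re - (X 1 0).re + ((Y 0 1).im + (Y 1 0).im) := by
    apply mul_left_cancel₀ hE; linarith
  obtain ⟨tX1, tX2⟩ := tX
  obtain ⟨tY1, tY2⟩ := tY
  clear c31 c32 hl hm hm' hn hmean hq
  constructor
  · ext i j
    fin_cases i <;> fin_cases j <;> simp [Complex.ext_iff] <;> constructor <;> linarith
  · ext i j
    fin_cases i <;> fin_cases j <;> simp [Complex.ext_iff] <;> constructor <;> linarith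

/-- `f`, `f_x`, `f_y` and `N` have constant frame components up to powers of `e^u`. Differentiating
the first three and pairing second derivatives with `N` yields the hypotheses of
`frame_coefficients`. -/
theorem maurerCartan_of_movingFrame {D : Set ℂ} (hD : IsOpen D) {u : ℂ → ℝ} {H : ℝ} {q : ℂ → ℂ}
    {f N : ℂ → R31} {F : ℂ → Mat2} (hf : IsConformalCMC D u H q f N)
    (hF : IsMovingFrame D u f N F) :
    HasMaurerCartanForm D F (laxA u q (1 + H)) (laxB u q (1 - H)) := by
  have key : ∀ z ∈ D, ∃ X Y : Mat2, dirMat F 1 z = F z * X ∧ dirMat F I z = F z * Y ∧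
      (1 / 2 : ℂ) • (X - I • Y) = laxA u q (1 + H) z ∧
      (1 / 2 : ℂ) • (X + I • Y) = laxB u q (1 - H) z := by
    intro z hz
    have hdet := hF.det_eq z hz
    have hcan : ∀ M : Mat2, F z * ((F z)⁻¹ * M) = M := fun M => by
      rw [← mul_assoc, Matrix.mul_nonsing_inv _ (by simp [hdet]), one_mul]
    obtain ⟨X, hX⟩ : ∃ X, dirMat F 1 z = F z * X := ⟨_, (hcan _).symm⟩
    obtain ⟨Y, hY⟩ : ∃ Y, dirMat F I z = F z * Y := ⟨_, (hcan _).symm⟩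
    have hFX : HasDir F (F z * X) 1 z := hX ▸ hF.smooth.hasDir hD hz 1
    have hFY : HasDir F (F z * Y) I z := hY ▸ hF.smooth.hasDir hD hz I
    have tX := trace_eq_zero_of_det_eq_one hD hz hFX hF.det_eq
    have tY := trace_eq_zero_of_det_eq_one hD hz hFY hF.det_eq
    have exp_cancel : ∀ (w : ℂ) (x : R31), herm x
        = ((Real.exp (1 * u w) : ℝ) : ℂ) • herm (Real.exp (-u w) • x) := by
      intro w x
      rw [herm_smul, smul_smul, ← ofReal_mul, ← Real.exp_add]
      simp
    have h0 : ∀ w ∈ D, herm (f w) = (fun _ => (1 : ℂ)) w • (F w * 1 * (F w)ᴴ) := fun w hw => by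
      simp [hF.frame0 w hw]
    have h1 : ∀ w ∈ D, herm (dx f w)
        = (fun w => ((Real.exp (1 * u w) : ℝ) : ℂ)) w • (F w * sigma1 * (F w)ᴴ) := fun w hw => by
      rw [exp_cancel w, hF.frame1 w hw]
    have h2 : ∀ w ∈ D, herm (dy f w)
        = (fun w => ((Real.exp (1 * u w) : ℝ) : ℂ)) w • (F w * sigma2 * (F w)ᴴ) := fun w hw => by
      rw [exp_cancel w, hF.frame2 w hw]
    have hN : herm (N z) = F z * sigma3 * (F z)ᴴ := (hF.frame3 z hz).symm
    have hc : ∀ v, HasLineDerivAt ℝ (fun _ : ℂ => (1 : ℂ)) 0 z v := fun v =>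
      hasDerivAt_const (0 : ℝ) (1 : ℂ)
    have he := hasLineDerivAt_ofReal_exp hD hf.smooth_u hz 1
    have sx : ContDiffOn ℝ ∞ (dx f) D := contDiffOn_fderiv_apply hD hf.smooth_f 1
    have sy : ContDiffOn ℝ ∞ (dy f) D := contDiffOn_fderiv_apply hD hf.smooth_f I
    have a1 := herm_fderiv_eq hD hz hFX hf.smooth_f (hc 1) h0
    have a2 := herm_fderiv_eq hD hz hFY hf.smooth_f (hc I) h0
    have b1 := h1 z hz
    have b2 := h2 z hz
    rw [← smul_mul_assoc, ← mul_smul_comm] at b1 b2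
    have c1 := mul_mul_conjTranspose_cancel hdet (a1.symm.trans b1)
    have c2 := mul_mul_conjTranspose_cancel hdet (a2.symm.trans b2)
    have dxx := herm_fderiv_eq hD hz hFX sx (he 1) h1
    have dxy := herm_fderiv_eq hD hz hFX sy (he 1) h2
    have dyx := herm_fderiv_eq hD hz hFY sx (he I) h1
    have dyy := herm_fderiv_eq hD hz hFY sy (he I) h2
    have hcomm : fderiv ℝ (dy f) z 1 = fderiv ℝ (dx f) z I :=
      fderiv_fderiv_comm hD hf.smooth_f hz I 1
    have c3 := mul_mul_conjTranspose_cancel hdet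
      (dxy.symm.trans ((congrArg herm hcomm).trans dyx))
    have hl := lor_eq_of_herm_eq hdet dxx hN
    have hm := lor_eq_of_herm_eq hdet dxy hN
    have hm' := lor_eq_of_herm_eq hdet dyx hN
    have hn := lor_eq_of_herm_eq hdet dyy hN
    rw [← hcomm] at hm'
    have hmean := hf.mean_curvature z hz
    have hhopf := hf.hopf z hz
    refine ⟨X, Y, hX, hY, ?_⟩
    have hE : Real.exp (u z) ≠ 0 := (Real.exp_pos _).ne'
    have hE2 : Real.exp (2 * u z) = Real.exp (u z) * Real.exp (u z) := by
      rw [← Real.exp_add]; ring_nf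
    have hEn : Real.exp (-u z) = (Real.exp (u z))⁻¹ := Real.exp_neg _
    have hq := hhopf
    change (1 / 4 : ℂ) * (((lor (fderiv ℝ (dx f) z 1) (N z) - lor (fderiv ℝ (dy f) z I) (N z) : ℝ) : ℂ)
      - 2 * I * ((lor (fderiv ℝ (dy f) z 1) (N z) : ℝ) : ℂ)) = q z at hq
    change (lor (fderiv ℝ (dx f) z 1) (N z) + lor (fderiv ℝ (dy f) z I) (N z)) / 2
      = H * Real.exp (2 * u z) at hmean
    have hu1 := dx_ofReal hD hf.smooth_u hz 1
    have hu2 := dx_ofReal hD hf.smooth_u hz I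
    generalize lor (fderiv ℝ (dx f) z 1) (N z) = l at *
    generalize lor (fderiv ℝ (dy f) z 1) (N z) = m at *
    generalize lor (fderiv ℝ (dy f) z I) (N z) = n at *
    rw [hE2] at hmean
    simp only [laxA, laxB, wirt, wirtBar, dx, dy, hu1, hu2, hEn]
    simp only [one_mul] at c1 c2 c3 hl hm hm' hn
    generalize Real.exp (u z) = E at *
    generalize fderiv ℝ u z 1 = u1 at *
    generalize fderiv ℝ u z I = u2 at *
    generalize q z = Q at *
    clear hFX hFY hX hY a1 a2 b1 b2 dxx dxy dyx dyy h0 h1 h2 hhopf he hc hcan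
    -- Since `N` corresponds to `σ₃`, pairing with it extracts the `σ₃`-component of `P`.
    have proj3 : ∀ {c : ℝ} {P : Mat2}, (c : ℂ) = -(1 / 2) * (P 0 0 * sigma3 1 1 + P 1 1 * sigma3 0 0
        - P 0 1 * sigma3 1 0 - P 1 0 * sigma3 0 1) → c = ((P 0 0).re - (P 1 1).re) / 2 := by
      intro c P h
      have h := congrArg Complex.re h
      simp [sigma3] at h
      rw [h]; ring
    replace hl := proj3 hl
    replace hm := proj3 hm
    replace hm' := proj3 hm'
    replace hn := proj3 hn
    simp [sigma1, sigma2, Matrix.mul_apply, Matrix.vecMul, dotProduct] at hl hm hm' hn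
    refine frame_coefficients hE tX tY c1 c2 c3 ?_ ?_ ?_ ?_ hmean hq <;> linarith
  refine ⟨hF.smooth, fun z hz => ?_, fun z hz => ?_⟩
  · obtain ⟨X, Y, hX, hY, hA, -⟩ := key z hz
    rw [wirtMat_eq, hX, hY, ← hA]
    simp only [mul_smul_comm, mul_sub]
  · obtain ⟨X, Y, hX, hY, -, hB⟩ := key z hz
    rw [wirtBarMat_eq, hX, hY, ← hB]
    simp only [mul_smul_comm, mul_add]

end CMCHyp
end

noncomputable section

namespace CMCHyp

/-! ### The equations of Gauss and Codazzi -/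

theorem contDiffOn_lor {D : Set ℂ} {a b : ℂ → R31} (ha : ContDiffOn ℝ ∞ a D)
    (hb : ContDiffOn ℝ ∞ b D) : ContDiffOn ℝ ∞ (fun z => lor (a z) (b z)) D := by
  have ha' := contDiffOn_pi.1 ha
  have hb' := contDiffOn_pi.1 hb
  exact ((((ha' 0).mul (hb' 0)).neg.add ((ha' 1).mul (hb' 1))).add ((ha' 2).mul (hb' 2))).add
    ((ha' 3).mul (hb' 3))

theorem contDiffOn_ofReal {D : Set ℂ} {g : ℂ → ℝ} (hg : ContDiffOn ℝ ∞ g D) :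
    ContDiffOn ℝ ∞ (fun z => (g z : ℂ)) D :=
  ofRealCLM.contDiff.comp_contDiffOn hg

/-- Smoothness of `q` is not part of `IsConformalCMC`; it is inherited from `f` and `N`. -/
theorem contDiffOn_hopf {D : Set ℂ} (hD : IsOpen D) {u : ℂ → ℝ} {H : ℝ} {q : ℂ → ℂ}
    {f N : ℂ → R31} (hf : IsConformalCMC D u H q f N) : ContDiffOn ℝ ∞ q D := by
  have sx : ContDiffOn ℝ ∞ (dx f) D := contDiffOn_fderiv_apply hD hf.smooth_f 1
  have sy : ContDiffOn ℝ ∞ (dy f) D := contDiffOn_fderiv_apply hD hf.smooth_f I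
  have h1 := contDiffOn_lor (contDiffOn_fderiv_apply hD sx 1) hf.smooth_N
  have h2 := contDiffOn_lor (contDiffOn_fderiv_apply hD sy I) hf.smooth_N
  have h3 := contDiffOn_lor (contDiffOn_fderiv_apply hD sy 1) hf.smooth_N
  refine ContDiffOn.congr ?_ fun z hz => (hf.hopf z hz).symm
  exact contDiffOn_const.mul ((contDiffOn_ofReal (h1.sub h2)).sub
    (contDiffOn_const.mul (contDiffOn_ofReal h3)))

/-! ### The twisted form with complex spectral parameter, and its flatness -/

/-- The `dx`-part of the twisted form with spectral parameter `l`, where `a` and `b` stand for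
`1 + H` and `1 - H`. -/
def twX (u : ℂ → ℝ) (Q : ℂ → ℂ) (a b : ℝ) (l : ℂ) (z : ℂ) : Mat2 :=
  !![(I / 2) * (fderiv ℝ u z I : ℝ), -(l⁻¹ * ((Real.exp (-1 * u z) : ℝ) * Q z))
      + l * ((Real.exp (1 * u z) : ℝ) * (b / 2));
    l⁻¹ * ((Real.exp (1 * u z) : ℝ) * (a / 2)) + l * ((Real.exp (-1 * u z) : ℝ) * conj (Q z)),
    -((I / 2) * (fderiv ℝ u z I : ℝ))]

/-- The `dy`-part of the twisted form with spectral parameter `l`. -/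
def twY (u : ℂ → ℝ) (Q : ℂ → ℂ) (a b : ℝ) (l : ℂ) (z : ℂ) : Mat2 :=
  !![-((I / 2) * (fderiv ℝ u z 1 : ℝ)), I * (-(l⁻¹ * ((Real.exp (-1 * u z) : ℝ) * Q z))
      - l * ((Real.exp (1 * u z) : ℝ) * (b / 2)));
    I * (l⁻¹ * ((Real.exp (1 * u z) : ℝ) * (a / 2)) - l * ((Real.exp (-1 * u z) : ℝ) * conj (Q z))),
    (I / 2) * (fderiv ℝ u z 1 : ℝ)]

/-- The directional derivative of `twX`. -/
def twX' (u : ℂ → ℝ) (Q : ℂ → ℂ) (a b : ℝ) (l v : ℂ) (z : ℂ) : Mat2 :=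
  !![(I / 2) * (fderiv ℝ (fun w => fderiv ℝ u w I) z v : ℝ),
    -(l⁻¹ * ((Real.exp (-1 * u z) : ℝ) * (fderiv ℝ Q z v - (fderiv ℝ u z v : ℝ) * Q z)))
      + l * ((Real.exp (1 * u z) : ℝ) * (fderiv ℝ u z v : ℝ) * (b / 2));
    l⁻¹ * ((Real.exp (1 * u z) : ℝ) * (fderiv ℝ u z v : ℝ) * (a / 2))
      + l * ((Real.exp (-1 * u z) : ℝ) * (conj (fderiv ℝ Q z v) - (fderiv ℝ u z v : ℝ) * conj (Q z))),
    -((I / 2) * (fderiv ℝ (fun w => fderiv ℝ u w I) z v : ℝ))]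

/-- The directional derivative of `twY`. -/
def twY' (u : ℂ → ℝ) (Q : ℂ → ℂ) (a b : ℝ) (l v : ℂ) (z : ℂ) : Mat2 :=
  !![-((I / 2) * (fderiv ℝ (fun w => fderiv ℝ u w 1) z v : ℝ)),
    I * (-(l⁻¹ * ((Real.exp (-1 * u z) : ℝ) * (fderiv ℝ Q z v - (fderiv ℝ u z v : ℝ) * Q z)))
      - l * ((Real.exp (1 * u z) : ℝ) * (fderiv ℝ u z v : ℝ) * (b / 2)));
    I * (l⁻¹ * ((Real.exp (1 * u z) : ℝ) * (fderiv ℝ u z v : ℝ) * (a / 2))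
      - l * ((Real.exp (-1 * u z) : ℝ) * (conj (fderiv ℝ Q z v) - (fderiv ℝ u z v : ℝ) * conj (Q z)))),
    (I / 2) * (fderiv ℝ (fun w => fderiv ℝ u w 1) z v : ℝ)]

theorem hasLineDerivAt_fun_mul {f g : ℂ → ℂ} {f' g' v z : ℂ}
    (hf : HasLineDerivAt ℝ f f' z v) (hg : HasLineDerivAt ℝ g g' z v) :
    HasLineDerivAt ℝ (fun w => f w * g w) (f' * g z + f z * g') z v := by
  have h0 : z + (0 : ℝ) • v = z := by simp
  have h := HasDerivAt.fun_mul hf hg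
  simp only [h0] at h
  exact h

theorem hasDir_twX_twY {D : Set ℂ} (hD : IsOpen D) {u : ℂ → ℝ} {Q : ℂ → ℂ}
    (hu : ContDiffOn ℝ ∞ u D) (hQ : ContDiffOn ℝ ∞ Q D) (a b : ℝ) (l : ℂ) {z : ℂ} (hz : z ∈ D)
    (v : ℂ) : HasDir (twX u Q a b l) (twX' u Q a b l v z) v z ∧
      HasDir (twY u Q a b l) (twY' u Q a b l v z) v z := by
  have hc : ∀ c : ℂ, HasLineDerivAt ℝ (fun w => ((fderiv ℝ u w c : ℝ) : ℂ))
      ((fderiv ℝ (fun w => fderiv ℝ u w c) z v : ℝ) : ℂ) z v := fun c =>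
    HasDerivAt.ofReal_comp (hasLineDerivAt_fderiv hD (contDiffOn_fderiv_apply hD hu c) hz v)
  have hE := hasLineDerivAt_ofReal_exp hD hu hz 1 v
  have hE' := hasLineDerivAt_ofReal_exp hD hu hz (-1) v
  have hq := hasLineDerivAt_fderiv hD hQ hz v
  have hq' : HasLineDerivAt ℝ (fun w => conj (Q w)) (conj (fderiv ℝ Q z v)) z v :=
    HasDerivAt.star hq
  have p1 := HasDerivAt.const_mul l⁻¹ (hasLineDerivAt_fun_mul hE' hq)
  have p2 := HasDerivAt.const_mul l (HasDerivAt.mul_const hE ((b : ℂ) / 2))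
  have p3 := HasDerivAt.const_mul l⁻¹ (HasDerivAt.mul_const hE ((a : ℂ) / 2))
  have p4 := HasDerivAt.const_mul l (hasLineDerivAt_fun_mul hE' hq')
  constructor
  · intro i j
    fin_cases i <;> fin_cases j
    · exact HasDerivAt.const_mul (I / 2) (hc I)
    · refine HasDerivAt.congr_deriv (HasDerivAt.fun_add (HasDerivAt.fun_neg p1) p2) ?_
      simp [twX', -mul_eq_mul_left_iff]; ring
    · refine HasDerivAt.congr_deriv (HasDerivAt.fun_add p3 p4) ?_
      simp [twX', -mul_eq_mul_left_iff]; ring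
    · exact HasDerivAt.fun_neg (HasDerivAt.const_mul (I / 2) (hc I))
  · intro i j
    fin_cases i <;> fin_cases j
    · exact HasDerivAt.fun_neg (HasDerivAt.const_mul (I / 2) (hc 1))
    · refine HasDerivAt.congr_deriv
        (HasDerivAt.const_mul I (HasDerivAt.fun_sub (HasDerivAt.fun_neg p1) p2)) ?_
      simp [twY', -mul_eq_mul_left_iff]; ring
    · refine HasDerivAt.congr_deriv (HasDerivAt.const_mul I (HasDerivAt.fun_sub p3 p4)) ?_
      simp [twY', -mul_eq_mul_left_iff]; ring
    · exact HasDerivAt.const_mul (I / 2) (hc 1)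

/-- The Gauss and Codazzi equations for metric factor `u`, Hopf differential `Q` and mean
curvature determined by `a b = 1 - H ^ 2`. -/
structure GaussCodazziAt (u : ℂ → ℝ) (Q : ℂ → ℂ) (ab : ℝ) (z : ℂ) : Prop where
  gauss : ((fderiv ℝ (fun w => fderiv ℝ u w 1) z 1 + fderiv ℝ (fun w => fderiv ℝ u w I) z I : ℝ) : ℂ)
    = 4 * (Real.exp (-1 * u z) : ℝ) ^ 2 * (Q z * conj (Q z)) + (Real.exp (1 * u z) : ℝ) ^ 2 * ab
  codazzi : fderiv ℝ Q z 1 + I * fderiv ℝ Q z I = 0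

/-- The diagonal entries are the Gauss equation: there `l` meets `l⁻¹` and only the product `a * b`
enters. The off-diagonal entries are multiples of the Codazzi equation by `l⁻¹` and of its conjugate
by `l`. So flatness holds for all `l ≠ 0` and survives `a ↦ s a`, `b ↦ s⁻¹ b`. -/
theorem twX'_sub_twY' {u : ℂ → ℝ} {Q : ℂ → ℂ} {a b : ℝ} {l z : ℂ} (hl : l ≠ 0)
    (h : GaussCodazziAt u Q (a * b) z) :
    twY' u Q a b l 1 z - twX' u Q a b l I z
      + (twX u Q a b l z * twY u Q a b l z - twY u Q a b l z * twX u Q a b l z) = 0 := by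
  have hg := h.gauss
  have hc := h.codazzi
  have hc' := congrArg conj hc
  simp only [map_add, map_mul, conj_I, map_zero] at hc'
  have hI : I ^ 2 = -1 := I_sq
  have hll : l * l⁻¹ = 1 := mul_inv_cancel₀ hl
  simp only [ofReal_add, ofReal_mul] at hg
  ext i j
  fin_cases i <;> fin_cases j <;>
    simp only [twX, twY, twX', twY', Matrix.add_apply, Matrix.sub_apply, Matrix.mul_apply,
      Fin.sum_univ_two, Matrix.of_apply, Matrix.cons_val', Matrix.cons_val_zero, Matrix.cons_val_one,
      Matrix.zero_apply, Fin.zero_eta, Fin.mk_one, Fin.isValue, Matrix.cons_val_fin_one]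
  · linear_combination (-(I / 2)) * hg + 2 * I * ((Real.exp (-1 * u z) : ℝ) ^ 2 * (Q z * conj (Q z))
      + (Real.exp (1 * u z) : ℝ) ^ 2 * a * b / 4) * hll
  · linear_combination (-I * l⁻¹ * (Real.exp (-1 * u z) : ℝ)) * hc + ((fderiv ℝ u z I : ℝ) *
      (-l⁻¹ * (Real.exp (-1 * u z) : ℝ) * Q z - l * (Real.exp (1 * u z) : ℝ) * b / 2)
      + l⁻¹ * (Real.exp (-1 * u z) : ℝ) * fderiv ℝ Q z I) * hI
  · linear_combination (-I * l * (Real.exp (-1 * u z) : ℝ)) * hc' + (-(fderiv ℝ u z I : ℝ) *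
      (l⁻¹ * (Real.exp (1 * u z) : ℝ) * a / 2 - l * (Real.exp (-1 * u z) : ℝ) * conj (Q z))
      - l * (Real.exp (-1 * u z) : ℝ) * conj (fderiv ℝ Q z I)) * hI
  · linear_combination (I / 2) * hg - 2 * I * ((Real.exp (-1 * u z) : ℝ) ^ 2 * (Q z * conj (Q z))
      + (Real.exp (1 * u z) : ℝ) ^ 2 * a * b / 4) * hll

/-- Equality of the mixed derivatives of `F`, with the invertible factor `F` cancelled. -/
theorem compatibility_of_frame {D : Set ℂ} (hD : IsOpen D) {F X Y : ℂ → Mat2}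
    (hF : SmoothMat D F) (hdet : ∀ z ∈ D, (F z).det ≠ 0) (hX : ∀ z ∈ D, dirMat F 1 z = F z * X z)
    (hY : ∀ z ∈ D, dirMat F I z = F z * Y z) {z : ℂ} (hz : z ∈ D) {X' Y' : Mat2}
    (hX' : HasDir X X' I z) (hY' : HasDir Y Y' 1 z) :
    Y' - X' + (X z * Y z - Y z * X z) = 0 := by
  have h1 := (HasDir.mul (hF.hasDir hD hz I) hX').congr_of_eqOn hD hz hX
  have h2 := (HasDir.mul (hF.hasDir hD hz 1) hY').congr_of_eqOn hD hz hY
  have h3 := dirMat_dirMat_comm hD hF hz 1 I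
  rw [HasDir.dirMat_eq hD (hF.dirMat hD 1) hz h1, HasDir.dirMat_eq hD (hF.dirMat hD I) hz h2,
    hX z hz, hY z hz] at h3
  have hu : IsUnit (F z) := (Matrix.isUnit_iff_isUnit_det _).2 (by simp [hdet z hz])
  refine hu.mul_left_cancel ?_
  have h4 : F z * X z * Y z + F z * Y' - (F z * Y z * X z + F z * X') = 0 := by rw [h3, sub_self]
  rw [mul_zero, ← h4]
  noncomm_ring

end CMCHyp
end

noncomputable section

namespace CMCHyp

/-- Converse of `twX'_sub_twY'`: flatness at `l = 1` alone suffices, with Gauss in the entry `0 0`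
and Codazzi in the entry `0 1`. -/
theorem gaussCodazziAt_of_twX'_sub_twY' {u : ℂ → ℝ} {Q : ℂ → ℂ} {a b : ℝ} {z : ℂ}
    (h : twY' u Q a b 1 1 z - twX' u Q a b 1 I z
      + (twX u Q a b 1 z * twY u Q a b 1 z - twY u Q a b 1 z * twX u Q a b 1 z) = 0) :
    GaussCodazziAt u Q (a * b) z := by
  have h00 := congrFun (congrFun h 0) 0
  have h01 := congrFun (congrFun h 0) 1
  have hI : I ^ 2 = -1 := I_sq
  simp only [twX, twY, twX', twY', Matrix.add_apply, Matrix.sub_apply, Matrix.mul_apply,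
    Fin.sum_univ_two, Matrix.of_apply, Matrix.cons_val', Matrix.cons_val_zero, Matrix.cons_val_one,
    Matrix.zero_apply, Fin.isValue, Matrix.cons_val_fin_one, inv_one, one_mul] at h00 h01
  constructor
  · simp only [ofReal_add, ofReal_mul, one_mul]
    linear_combination (2 * I) * h00 + (fderiv ℝ (fun w => fderiv ℝ u w 1) z 1
      + fderiv ℝ (fun w => fderiv ℝ u w I) z I - (4 * (Real.exp (-1 * u z) : ℝ) ^ 2
      * (Q z * conj (Q z)) + (Real.exp (u z) : ℝ) ^ 2 * (a * b)) : ℂ) * hI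
  · have hE : ((Real.exp (-1 * u z) : ℝ) : ℂ) ≠ 0 := by exact_mod_cast (Real.exp_pos _).ne'
    apply mul_left_cancel₀ hE
    linear_combination I * h01 + ((Real.exp (-1 * u z) : ℝ) * fderiv ℝ Q z 1
      + I * (fderiv ℝ u z I : ℝ) * ((Real.exp (-1 * u z) : ℝ) * Q z
        + (Real.exp (u z) : ℝ) * b / 2)) * hI

/-- Only the square of the root appears, whence the independence of its choice. The factors `θ^{±1}`
combine with the `θ^{∓2}` of the Hopf terms, so that `θ` enters each off-diagonal entry only through
`θ` or `θ⁻¹`. -/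
theorem gaugeG_conj (θ : Circle) (M : Mat2) :
    gaugeG θ * M * (gaugeG θ)⁻¹ = !![M 1 1, (θ : ℂ) * M 1 0; (θ : ℂ)⁻¹ * M 0 1, M 0 0] := by
  have hθ : (θ : ℂ) ≠ 0 := Circle.coe_ne_zero θ
  have h2 : (θ : ℂ) ^ (1 / 2 : ℂ) * (θ : ℂ) ^ (1 / 2 : ℂ) = θ := by
    rw [← Complex.cpow_add _ _ hθ]; norm_num
  have hm : (θ : ℂ) ^ (-(1 / 2) : ℂ) = ((θ : ℂ) ^ (1 / 2 : ℂ))⁻¹ := Complex.cpow_neg _ _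
  have h0 : (θ : ℂ) ^ (1 / 2 : ℂ) ≠ 0 := fun h => hθ (by rw [← h2, h, zero_mul])
  unfold gaugeG
  rw [hm]
  generalize (θ : ℂ) ^ (1 / 2 : ℂ) = t at *
  have hT : (!![0, t; t⁻¹, 0] : Mat2) * !![0, t; t⁻¹, 0] = 1 := by
    ext i j
    fin_cases i <;> fin_cases j <;> simp [Matrix.mul_apply, h0]
  have hI : I * -I = 1 := by simp
  have hinv : (I • !![0, t; t⁻¹, 0] : Mat2)⁻¹ = (-I) • !![0, t; t⁻¹, 0] := by
    apply Matrix.inv_eq_right_inv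
    rw [smul_mul_smul_comm, hT, hI, one_smul]
  rw [hinv, ← h2, smul_mul_assoc, smul_mul_smul_comm, hI, one_smul]
  ext i j
  fin_cases i <;> fin_cases j <;> simp [Matrix.mul_apply, Matrix.vecMul, dotProduct] <;>
    field_simp

/-- On the unit circle `conj θ = θ⁻¹`, so the gauged form is a Laurent polynomial in `θ` and extends
to `λ` off the circle. -/
theorem twA_twB_eq {D : Set ℂ} (hD : IsOpen D) {u : ℂ → ℝ} (hu : ContDiffOn ℝ ∞ u D) (H : ℝ)
    (Q : ℂ → ℂ) (s : ℝ) (θ : Circle) {z : ℂ} (hz : z ∈ D) :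
    twA u H Q s θ z + twB u H Q s θ z = twX u Q (s * (1 + H)) (s⁻¹ * (1 - H)) θ z ∧
    I • (twA u H Q s θ z - twB u H Q s θ z) = twY u Q (s * (1 + H)) (s⁻¹ * (1 - H)) θ z := by
  have hu1 := dx_ofReal hD hu hz 1
  have hu2 := dx_ofReal hD hu hz I
  have hθ : (θ : ℂ) ≠ 0 := Circle.coe_ne_zero θ
  have hθ' : conj (θ : ℂ) = (θ : ℂ)⁻¹ := (Circle.coe_inv_eq_conj θ).symm.trans (Circle.coe_inv θ)
  simp only [twA, twB, gaugeG_conj]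
  constructor
  · ext i j
    fin_cases i <;> fin_cases j <;>
      simp [defA, defB, laxA, laxB, twX, wirt, wirtBar, dx, dy, hu1, hu2, hopfTheta, hθ'] <;>
      field_simp <;> ring
  · ext i j
    fin_cases i <;> fin_cases j <;>
      simp [defA, defB, laxA, laxB, twY, wirt, wirtBar, dx, dy, hu1, hu2, hopfTheta, hθ'] <;>
      field_simp <;> ring

end CMCHyp
end

noncomputable section

namespace CMCHyp

/-! ### Gauss and Codazzi for the given family -/

theorem IsAssociatedFamily.contDiffOn_hopf {D : Set ℂ} (hD : IsOpen D) {u : ℂ → ℝ} {H : ℝ}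
    {Q : ℂ → ℂ} {f N : Circle → ℂ → R31} (hf : IsAssociatedFamily D u H Q f N) :
    ContDiffOn ℝ ∞ Q D := by
  have h : hopfTheta Q 1 = Q := by ext z; simp [hopfTheta]
  exact h ▸ CMCHyp.contDiffOn_hopf hD (hf 1)

theorem maurerCartan_of_associatedFamily {D : Set ℂ} (hD : IsOpen D) {u : ℂ → ℝ} {H : ℝ}
    {Q : ℂ → ℂ} {f N : Circle → ℂ → R31} (hf : IsAssociatedFamily D u H Q f N)
    {F : Circle → ℂ → Mat2} (hF : ∀ θ : Circle, IsMovingFrame D u (f θ) (N θ) (F θ)) (θ : Circle) :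
    HasMaurerCartanForm D (F θ) (defA u H Q 1 θ) (defB u H Q 1 θ) := by
  have h := maurerCartan_of_movingFrame hD (hf θ) (hF θ)
  simpa only [defA, defB, one_mul, inv_one] using h

theorem gaugeG_det (θ : Circle) : (gaugeG θ).det ≠ 0 := by
  have hθ : (θ : ℂ) ≠ 0 := Circle.coe_ne_zero θ
  have hm : (θ : ℂ) ^ (1 / 2 : ℂ) * (θ : ℂ) ^ (-(1 / 2) : ℂ) = 1 := by
    rw [← Complex.cpow_add _ _ hθ]; norm_num
  rw [gaugeG, Matrix.det_smul, Matrix.det_fin_two_of, hm]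
  simp

/-- The member `θ = 1` suffices: the invertible frame `F G⁻¹` has the Maurer-Cartan form `G Ω G⁻¹`,
which is the twisted form at `l = 1`. -/
theorem gaussCodazzi_of_associatedFamily {D : Set ℂ} (hD : IsOpen D) {u : ℂ → ℝ} {H : ℝ}
    {Q : ℂ → ℂ} {f N : Circle → ℂ → R31} (hf : IsAssociatedFamily D u H Q f N)
    {F : Circle → ℂ → Mat2} (hF : ∀ θ : Circle, IsMovingFrame D u (f θ) (N θ) (F θ))
    {z : ℂ} (hz : z ∈ D) : GaussCodazziAt u Q ((1 + H) * (1 - H)) z := by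
  have hmc := maurerCartan_of_associatedFamily hD hf hF 1
  have hu := (hf 1).smooth_u
  have hQ := hf.contDiffOn_hopf hD
  set g : Mat2 := gaugeG 1 with hg
  have hgu : IsUnit g.det := (gaugeG_det 1).isUnit
  have hgi : g⁻¹ * g = 1 := Matrix.nonsing_inv_mul _ hgu
  have hsm : SmoothMat D (fun w => F 1 w * g⁻¹) := by
    intro i j
    simp only [Matrix.mul_apply, Fin.sum_univ_two]
    exact ((hmc.smooth i 0).mul contDiffOn_const).add ((hmc.smooth i 1).mul contDiffOn_const)
  have hdir : ∀ w ∈ D, ∀ v W, dirMat (F 1) v w = F 1 w * W →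
      dirMat (fun w => F 1 w * g⁻¹) v w = F 1 w * g⁻¹ * (g * W * g⁻¹) := by
    intro w hw v W hW
    have h1 := ((hmc.smooth.hasDir hD hw v).mul (hasDir_const g⁻¹))
    rw [HasDir.dirMat_eq hD hsm hw h1, mul_zero, add_zero, hW]
    calc F 1 w * W * g⁻¹ = F 1 w * (1 * (W * g⁻¹)) := by rw [one_mul, mul_assoc]
      _ = _ := by rw [← hgi]; noncomm_ring
  have htw : ∀ w ∈ D, _ := fun w hw => twA_twB_eq hD hu H Q 1 1 hw
  simp only [one_mul, inv_one, Circle.coe_one] at htw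
  have hX : ∀ w ∈ D, dirMat (fun w => F 1 w * g⁻¹) 1 w
      = F 1 w * g⁻¹ * twX u Q (1 + H) (1 - H) 1 w := by
    intro w hw
    rw [hdir w hw 1 _ (dirMat_one_eq_of_maurerCartan hmc hw), ← (htw w hw).1, twA, twB, ← hg]
    noncomm_ring
  have hY : ∀ w ∈ D, dirMat (fun w => F 1 w * g⁻¹) I w
      = F 1 w * g⁻¹ * twY u Q (1 + H) (1 - H) 1 w := by
    intro w hw
    rw [hdir w hw I _ (dirMat_I_eq_of_maurerCartan hmc hw), ← (htw w hw).2, twA, twB, ← hg]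
    simp only [mul_smul_comm, smul_mul_assoc, mul_sub, sub_mul]
  refine gaussCodazziAt_of_twX'_sub_twY' (compatibility_of_frame hD hsm ?_ hX hY hz
    (hasDir_twX_twY hD hu hQ _ _ _ hz I).1 (hasDir_twX_twY hD hu hQ _ _ _ hz 1).2)
  intro w hw
  rw [Matrix.det_mul, (hF 1).det_eq w hw, one_mul]
  exact ((Matrix.isUnit_nonsing_inv_det_iff).2 hgu).ne_zero

/-! ### The parameter for which the deformed form is unitary -/

theorem div_pos_of_one_lt_abs {H : ℝ} (hH : 1 < |H|) : 0 < (H - 1) / (H + 1) := by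
  rcases lt_abs.1 hH with h | h
  · exact div_pos (by linarith) (by linarith)
  · exact div_pos_of_neg_of_neg (by linarith) (by linarith)

/-- Both sides say `s² (H + 1) = H - 1`, where `H + 1 ≠ 0`. -/
theorem deformation_balanced_iff {H s : ℝ} (hH : 1 < |H|) (hs : 0 < s) :
    s * (1 + H) = -(s⁻¹ * (1 - H)) ↔ s = Real.sqrt ((H - 1) / (H + 1)) := by
  have h1 : H + 1 ≠ 0 := by
    rintro h
    rw [show H = -1 by linarith] at hH
    simp at hH
  rw [eq_comm (a := s), Real.sqrt_eq_iff_mul_self_eq (div_pos_of_one_lt_abs hH).le hs.le]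
  field_simp
  constructor <;> intro h <;> linarith

/-- The terms with `du` and `q` are always skew-Hermitian, so only `a` and `b` matter. The vector
`1` at the origin already detects `a = -b`, because `q` cancels in the entry `0 1`. -/
theorem isSu2Form_lax_iff {D : Set ℂ} (hD : IsOpen D) (hD0 : (0 : ℂ) ∈ D) {u : ℂ → ℝ}
    (hu : ContDiffOn ℝ ∞ u D) (q : ℂ → ℂ) (a b : ℝ) :
    IsSu2Form D (laxA u q a) (laxB u q b) ↔ a = -b := by
  constructor
  · intro h
    have h1 := (h 0 hD0 1).1
    have h2 := congrFun (congrFun h1 0) 1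
    simp [laxA, laxB, -Complex.ofReal_exp] at h2
    have h3 := congrArg Complex.re h2
    simp [-Complex.ofReal_exp] at h3
    have h4 : Real.exp (u 0) * (a + b) = 0 := by linarith
    have h5 := (mul_eq_zero.1 h4).resolve_left (Real.exp_pos _).ne'
    linarith
  · rintro rfl z hz v
    have hu1 := dx_ofReal hD hu hz 1
    have hu2 := dx_ofReal hD hu hz I
    constructor
    · ext i j
      fin_cases i <;> fin_cases j <;>
        simp [laxA, laxB, wirt, wirtBar, dx, dy, hu1, hu2, -Complex.ofReal_exp,
          -mul_eq_mul_left_iff, -mul_eq_mul_right_iff] <;> ring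
    · simp [Matrix.trace_fin_two, laxA, laxB]
      ring

end CMCHyp
end

noncomputable section

namespace CMCHyp

/-! ### The twisted form as a flat connection in the loop algebra -/

/-- The connection form `X dx + Y dy`. -/
def connectionForm {A : Type*} [NormedRing A] [NormedAlgebra ℝ A] (X Y : ℂ → A) (z : ℂ) :
    ℂ →L[ℝ] A :=
  reCLM.smulRight (X z) + imCLM.smulRight (Y z)

theorem connectionForm_apply {A : Type*} [NormedRing A] [NormedAlgebra ℝ A] (X Y : ℂ → A)
    (z v : ℂ) : connectionForm X Y z v = v.re • X z + v.im • Y z := by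
  simp [connectionForm]

theorem contDiffOn_connectionForm {A : Type*} [NormedRing A] [NormedAlgebra ℝ A] {X Y : ℂ → A}
    {D : Set ℂ} (hX : ContDiffOn ℝ ∞ X D) (hY : ContDiffOn ℝ ∞ Y D) :
    ContDiffOn ℝ ∞ (connectionForm X Y) D :=
  ((ContinuousLinearMap.smulRightL ℝ ℂ A reCLM).contDiff.comp_contDiffOn hX).add
    ((ContinuousLinearMap.smulRightL ℝ ℂ A imCLM).contDiff.comp_contDiffOn hY)

theorem isFlatOn_connectionForm {A : Type*} [NormedRing A] [NormedAlgebra ℝ A] {X Y : ℂ → A}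
    {D : Set ℂ} (hD : IsOpen D) (hX : ContDiffOn ℝ ∞ X D) (hY : ContDiffOn ℝ ∞ Y D)
    (h : ∀ z ∈ D, fderiv ℝ Y z 1 - fderiv ℝ X z I + (X z * Y z - Y z * X z) = 0) :
    IsFlatOn (connectionForm X Y) D := by
  intro z hz a b
  have dX := differentiableAt_of_contDiffOn hD hX hz
  have dY := differentiableAt_of_contDiffOn hD hY hz
  have h1 : HasFDerivAt (connectionForm X Y)
      (((ContinuousLinearMap.smulRightL ℝ ℂ A reCLM).comp (fderiv ℝ X z))
        + ((ContinuousLinearMap.smulRightL ℝ ℂ A imCLM).comp (fderiv ℝ Y z))) z :=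
    ((ContinuousLinearMap.smulRightL ℝ ℂ A reCLM).hasFDerivAt.comp z dX.hasFDerivAt).add
      ((ContinuousLinearMap.smulRightL ℝ ℂ A imCLM).hasFDerivAt.comp z dY.hasFDerivAt)
  have h2 : ∀ a b, fderiv ℝ (connectionForm X Y) z a b
      = b.re • fderiv ℝ X z a + b.im • fderiv ℝ Y z a := by
    intro a b
    rw [h1.fderiv]
    simp
  have h3 : ∀ (L : ℂ →L[ℝ] A) (a : ℂ), L a = a.re • L 1 + a.im • L I := by
    intro L a
    rw [← map_smul, ← map_smul, ← map_add]
    congr 1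
    simp
  -- The curvature is an alternating form on the plane, so its value on `(a, b)` is its value on
  -- `(1, I)` times the determinant of `(a, b)`.
  have h4 := congrArg (fun w => (a.re * b.im - a.im * b.re) • w) (h z hz)
  simp only [smul_zero] at h4
  rw [← h4, h2, h2, h3 (fderiv ℝ X z) a, h3 (fderiv ℝ Y z) a, h3 (fderiv ℝ X z) b,
    h3 (fderiv ℝ Y z) b, connectionForm_apply, connectionForm_apply]
  simp only [add_mul, mul_add, smul_mul_smul_comm, smul_add, smul_sub, smul_smul, sub_smul]
  rw [mul_comm b.re a.re, mul_comm b.im a.im, mul_comm b.re a.im, mul_comm b.im a.re]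
  abel

/-- A family of continuous representations `ev k` of a Banach algebra by `2 × 2` matrices that
separates points, together with elements that represent the constant loop `σ₃` and the
off-diagonal loops `λ^{±1} (0, x; y, 0)` with spectral parameter `λ = l k`. -/
structure LoopRepresentation (A K : Type*) [NormedRing A] [NormedAlgebra ℂ A] (l : K → ℂ) where
  ev : K → A →ₐ[ℂ] Mat2
  continuous_ev : ∀ k i j, Continuous fun g => ev k g i j
  ext : ∀ g h, (∀ k, ev k g = ev k h) → g = h
  diag : A
  pos : ℂ → ℂ → A
  neg : ℂ → ℂ → A
  ev_diag : ∀ k, ev k diag = sigma3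
  ev_pos : ∀ k x y, ev k (pos x y) = l k • !![0, x; y, 0]
  ev_neg : ∀ k x y, ev k (neg x y) = (l k)⁻¹ • !![0, x; y, 0]

namespace LoopRepresentation

variable {A K : Type*} [NormedRing A] [NormedAlgebra ℂ A] {l : K → ℂ}
  (R : LoopRepresentation A K l)

/-- The `dx`-part of the twisted form in the loop algebra. -/
def formX (u : ℂ → ℝ) (Q : ℂ → ℂ) (a b : ℝ) (z : ℂ) : A :=
  (I / 2 * (fderiv ℝ u z I : ℝ) : ℂ) • R.diag
    - ((Real.exp (-1 * u z) : ℝ) * Q z : ℂ) • R.neg 1 0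
    + ((Real.exp (1 * u z) : ℝ) * (b / 2) : ℂ) • R.pos 1 0
    + ((Real.exp (1 * u z) : ℝ) * (a / 2) : ℂ) • R.neg 0 1
    + ((Real.exp (-1 * u z) : ℝ) * conj (Q z) : ℂ) • R.pos 0 1

/-- The `dy`-part of the twisted form in the loop algebra. -/
def formY (u : ℂ → ℝ) (Q : ℂ → ℂ) (a b : ℝ) (z : ℂ) : A :=
  (-(I / 2 * (fderiv ℝ u z 1 : ℝ)) : ℂ) • R.diag
    - (I * ((Real.exp (-1 * u z) : ℝ) * Q z) : ℂ) • R.neg 1 0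
    - (I * ((Real.exp (1 * u z) : ℝ) * (b / 2)) : ℂ) • R.pos 1 0
    + (I * ((Real.exp (1 * u z) : ℝ) * (a / 2)) : ℂ) • R.neg 0 1
    - (I * ((Real.exp (-1 * u z) : ℝ) * conj (Q z)) : ℂ) • R.pos 0 1

theorem ev_formX (u : ℂ → ℝ) (Q : ℂ → ℂ) (a b : ℝ) (k : K) (z : ℂ) :
    R.ev k (R.formX u Q a b z) = twX u Q a b (l k) z := by
  simp only [formX, map_add, map_sub, map_smul, R.ev_diag, R.ev_pos, R.ev_neg]
  ext i j
  fin_cases i <;> fin_cases j <;> simp [twX, sigma3, -Complex.ofReal_exp] <;> ring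

theorem ev_formY (u : ℂ → ℝ) (Q : ℂ → ℂ) (a b : ℝ) (k : K) (z : ℂ) :
    R.ev k (R.formY u Q a b z) = twY u Q a b (l k) z := by
  simp only [formY, map_add, map_sub, map_smul, R.ev_diag, R.ev_pos, R.ev_neg]
  ext i j
  fin_cases i <;> fin_cases j <;> simp [twY, sigma3, -Complex.ofReal_exp] <;> ring

/-- An entry of the evaluation of a loop, as a continuous real linear functional. -/
def entry (k : K) (i j : Fin 2) : A →L[ℝ] ℂ :=
  ContinuousLinearMap.restrictScalars ℝ
    { toFun := fun g => R.ev k g i j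
      map_add' := fun g h => by rw [map_add]; rfl
      map_smul' := fun c g => by rw [map_smul]; rfl
      cont := R.continuous_ev k i j }

theorem hasDir_ev {G : ℂ → A} {G' : ℂ →L[ℝ] A} {z : ℂ} (h : HasFDerivAt G G' z) (k : K) (v : ℂ) :
    HasDir (fun w => R.ev k (G w)) (R.ev k (G' v)) v z := fun i j =>
  ((R.entry k i j).hasFDerivAt.comp z h).hasLineDerivAt v

theorem contDiffOn_formX_formY {D : Set ℂ} (hD : IsOpen D) {u : ℂ → ℝ} {Q : ℂ → ℂ}
    (hu : ContDiffOn ℝ ∞ u D) (hQ : ContDiffOn ℝ ∞ Q D) (a b : ℝ) :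
    ContDiffOn ℝ ∞ (R.formX u Q a b) D ∧ ContDiffOn ℝ ∞ (R.formY u Q a b) D := by
  have h1 := contDiffOn_ofReal (contDiffOn_fderiv_apply hD hu 1)
  have h2 := contDiffOn_ofReal (contDiffOn_fderiv_apply hD hu I)
  have hQ' : ContDiffOn ℝ ∞ (fun z => conj (Q z)) D := conjCLE.contDiff.comp_contDiffOn hQ
  have hE : ∀ c : ℝ, ContDiffOn ℝ ∞ (fun z => ((Real.exp (c * u z) : ℝ) : ℂ)) D := fun c =>
    contDiffOn_ofReal (contDiffOn_const.mul hu).exp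
  have h3 := (hE (-1)).mul hQ
  have h4 := (hE 1).mul (contDiffOn_const (c := (b / 2 : ℂ)))
  have h5 := (hE 1).mul (contDiffOn_const (c := (a / 2 : ℂ)))
  have h6 := (hE (-1)).mul hQ'
  have cI : ContDiffOn ℝ ∞ (fun _ : ℂ => I) D := contDiffOn_const
  have cI2 : ContDiffOn ℝ ∞ (fun _ : ℂ => I / 2) D := contDiffOn_const
  have hs : ∀ {φ : ℂ → ℂ} (_ : ContDiffOn ℝ ∞ φ D) (g : A),
      ContDiffOn ℝ ∞ (fun z => φ z • g) D := fun hφ g => hφ.smul contDiffOn_const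
  exact ⟨((((hs (cI2.mul h2) _).sub (hs h3 _)).add (hs h4 _)).add (hs h5 _)).add (hs h6 _),
    ((((hs (cI2.mul h1).neg _).sub (hs (cI.mul h3) _)).sub (hs (cI.mul h4) _)).add
      (hs (cI.mul h5) _)).sub (hs (cI.mul h6) _)⟩

/-- Evaluations separate points, so flatness in the algebra is the matrix identity `twX'_sub_twY'`
at each `l k`. A single solution in the algebra then gives the frames for all `k`. -/
theorem exists_frame [CompleteSpace A] (hl : ∀ k, l k ≠ 0) {D : Set ℂ} (hD : IsOpen D)
    (hDs : IsSimplyConnected D) (hD0 : (0 : ℂ) ∈ D) {u : ℂ → ℝ} {Q : ℂ → ℂ}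
    (hu : ContDiffOn ℝ ∞ u D) (hQ : ContDiffOn ℝ ∞ Q D) {a b : ℝ}
    (h : ∀ z ∈ D, GaussCodazziAt u Q (a * b) z) :
    ∃ F : ℂ → A, F 0 = 1 ∧ ∀ k, SmoothMat D (fun z => R.ev k (F z)) ∧ ∀ z ∈ D,
      dirMat (fun w => R.ev k (F w)) 1 z = R.ev k (F z) * twX u Q a b (l k) z ∧
      dirMat (fun w => R.ev k (F w)) I z = R.ev k (F z) * twY u Q a b (l k) z := by
  obtain ⟨hX, hY⟩ := R.contDiffOn_formX_formY hD hu hQ a b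
  have hs := contDiffOn_connectionForm hX hY
  have hflat : IsFlatOn (connectionForm (R.formX u Q a b) (R.formY u Q a b)) D := by
    refine isFlatOn_connectionForm hD hX hY fun z hz => R.ext _ _ fun k => ?_
    have e1 := R.hasDir_ev (differentiableAt_of_contDiffOn hD hX hz).hasFDerivAt k I
    have e2 := R.hasDir_ev (differentiableAt_of_contDiffOn hD hY hz).hasFDerivAt k 1
    simp only [ev_formX, ev_formY] at e1 e2
    simp only [map_add, map_sub, map_mul, map_zero, ev_formX, ev_formY]
    rw [e1.unique (hasDir_twX_twY hD hu hQ a b (l k) hz I).1,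
      e2.unique (hasDir_twX_twY hD hu hQ a b (l k) hz 1).2]
    exact twX'_sub_twY' (hl k) (h z hz)
  obtain ⟨F, hF0, hF⟩ := exists_flat_frame hD hDs
    (hs.of_le (mod_cast le_top : ((2 : ℕ∞) : WithTop ℕ∞) ≤ ∞)) hflat hD0
  have hFs := contDiffOn_of_hasFDerivAt_smul hD hs hF
  refine ⟨F, hF0, fun k => ?_⟩
  have hsm : SmoothMat D (fun z => R.ev k (F z)) := fun i j =>
    (R.entry k i j).contDiff.comp_contDiffOn hFs
  refine ⟨hsm, fun z hz => ⟨?_, ?_⟩⟩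
  · rw [HasDir.dirMat_eq hD hsm hz (R.hasDir_ev (hF z hz) k 1), ← R.ev_formX, ← map_mul]
    simp [connectionForm_apply]
  · rw [HasDir.dirMat_eq hD hsm hz (R.hasDir_ev (hF z hz) k I), ← R.ev_formY, ← map_mul]
    simp [connectionForm_apply]

end LoopRepresentation

/-! ### The annulus algebra as a loop representation -/

section LoopRing

attribute [local instance] Matrix.linftyOpNormedRing Matrix.linftyOpNormedAlgebra

theorem sigma3_conj_diag : sigma3 * sigma3 * sigma3⁻¹ = (-1 : ℂ) ^ (0 : ℤ) • sigma3 := by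
  rw [sigma3_inv, sigma3_mul_self, one_mul, zpow_zero, one_smul]

theorem sigma3_conj_offDiag (n : ℤ) (hn : (-1 : ℂ) ^ n = -1) (x y : ℂ) :
    sigma3 * !![0, x; y, 0] * sigma3⁻¹ = (-1 : ℂ) ^ n • !![0, x; y, 0] := by
  rw [sigma3_inv, hn]
  ext i j
  fin_cases i <;> fin_cases j <;> simp [sigma3]

/-- The normed ring of continuous maps on the annulus. -/
@[reducible] def annulusNormedRing (R : Type*) [NormedRing R] : NormedRing C(Annulus, R) :=
  inferInstance

/-- The normed algebra of continuous maps on the annulus. -/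
@[reducible] def annulusNormedAlgebra (R : Type*) [NormedRing R] [NormedAlgebra ℂ R] :
    NormedAlgebra ℂ C(Annulus, R) :=
  inferInstance

/-- The algebra `loopAlgebra` as a Banach algebra with the supremum norm. -/
def LoopRing : Type := loopAlgebra

instance : NormedRing LoopRing :=
  @Subalgebra.normedRing ℂ _ C(Annulus, Mat2) (annulusNormedRing Mat2)
    (annulusNormedAlgebra Mat2).toAlgebra loopAlgebra

instance : NormedAlgebra ℂ LoopRing :=
  @Subalgebra.toNormedAlgebra ℂ C(Annulus, Mat2) (annulusNormedRing Mat2).toSeminormedRing _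
    (annulusNormedAlgebra Mat2) loopAlgebra

instance : CompleteSpace LoopRing :=
  (inferInstance : CompleteSpace loopAlgebra)

/-- A loop as a continuous map on the annulus. -/
def LoopRing.val (g : LoopRing) : C(Annulus, Mat2) := Subtype.val g

theorem LoopRing.val_mem (g : LoopRing) : g.val ∈ loopAlgebra := Subtype.property g

theorem LoopRing.continuous_val : Continuous LoopRing.val :=
  (continuous_subtype_val : Continuous (Subtype.val : loopAlgebra → C(Annulus, Mat2)))

/-- Evaluation of loops at the points of the annulus. -/
def loopRepresentation : LoopRepresentation LoopRing Annulus spectral where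
  ev k :=
    { toFun := fun g => g.val k
      map_one' := rfl
      map_mul' := fun _ _ => rfl
      map_zero' := rfl
      map_add' := fun _ _ => rfl
      commutes' := fun _ => rfl }
  continuous_ev k i j := by
    have h : Continuous fun g : LoopRing => g.val k :=
      (continuous_eval_const k).comp LoopRing.continuous_val
    exact h.matrix_elem i j
  ext _ _ h := Subtype.ext (ContinuousMap.ext h)
  diag := (⟨loopMonomial 0 sigma3, loopMonomial_mem sigma3_conj_diag⟩ : loopAlgebra)
  pos x y := (⟨loopMonomial 1 !![0, x; y, 0],
    loopMonomial_mem (sigma3_conj_offDiag 1 (by norm_num) x y)⟩ : loopAlgebra)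
  neg x y := (⟨loopMonomial (-1) !![0, x; y, 0],
    loopMonomial_mem (sigma3_conj_offDiag (-1) (by norm_num) x y)⟩ : loopAlgebra)
  ev_diag k := by
    change spectral k ^ (0 : ℤ) • sigma3 = sigma3
    rw [zpow_zero, one_smul]
  ev_pos k x y := by
    change spectral k ^ (1 : ℤ) • !![0, x; y, 0] = _
    rw [zpow_one]
  ev_neg k x y := by
    change spectral k ^ (-1 : ℤ) • !![0, x; y, 0] = _
    rw [_root_.zpow_neg_one]

end LoopRing

end CMCHyp
end

noncomputable section

namespace CMCHyp

/-! ### Frames with an `su(2)`-valued Maurer-Cartan form are unitary -/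

theorem eqOn_of_hasLineDerivAt_zero {D : Set ℂ} (hD : IsOpen D) (hDc : IsPreconnected D)
    {φ : ℂ → ℂ} (hφ : ContDiffOn ℝ ∞ φ D) (h1 : ∀ z ∈ D, HasLineDerivAt ℝ φ 0 z 1)
    (h2 : ∀ z ∈ D, HasLineDerivAt ℝ φ 0 z I) {z w : ℂ} (hz : z ∈ D) (hw : w ∈ D) : φ z = φ w := by
  refine hD.is_const_of_fderiv_eq_zero (𝕜 := ℝ) hDc (hφ.differentiableOn (by simp)) ?_ hz hw
  intro x hx
  have e1 : fderiv ℝ φ x 1 = 0 := HasDerivAt.unique (hasLineDerivAt_fderiv hD hφ hx 1) (h1 x hx)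
  have e2 : fderiv ℝ φ x I = 0 := HasDerivAt.unique (hasLineDerivAt_fderiv hD hφ hx I) (h2 x hx)
  ext v
  have : v = v.re • (1 : ℂ) + v.im • I := by simp
  rw [this, map_add, map_smul, map_smul, e1, e2]
  simp

theorem contDiffOn_star {D : Set ℂ} {φ : ℂ → ℂ} (hφ : ContDiffOn ℝ ∞ φ D) :
    ContDiffOn ℝ ∞ (fun z => star (φ z)) D :=
  conjCLE.contDiff.comp_contDiffOn hφ

theorem SmoothMat.mul {D : Set ℂ} {F G : ℂ → Mat2} (hF : SmoothMat D F) (hG : SmoothMat D G) :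
    SmoothMat D (fun z => F z * G z) := by
  intro i j
  simp only [Matrix.mul_apply, Fin.sum_univ_two]
  exact ((hF i 0).mul (hG 0 j)).add ((hF i 1).mul (hG 1 j))

theorem smoothMat_const (D : Set ℂ) (M : Mat2) : SmoothMat D (fun _ => M) := fun _ _ =>
  contDiffOn_const

theorem SmoothMat.conjTranspose {D : Set ℂ} {F : ℂ → Mat2} (hF : SmoothMat D F) :
    SmoothMat D (fun z => (F z)ᴴ) := fun i j => contDiffOn_star (hF j i)

theorem hasLineDerivAt_det {G : ℂ → Mat2} {X : Mat2} {v z : ℂ} (hG : HasDir G (G z * X) v z)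
    (hX : X.trace = 0) : HasLineDerivAt ℝ (fun w => (G w).det) 0 z v := by
  have h := HasDerivAt.fun_sub (hasLineDerivAt_fun_mul (hG 0 0) (hG 1 1))
    (hasLineDerivAt_fun_mul (hG 0 1) (hG 1 0))
  simp only [HasLineDerivAt, Matrix.det_fin_two]
  refine h.congr_deriv ?_
  rw [Matrix.trace_fin_two] at hX
  simp only [Matrix.mul_apply, Fin.sum_univ_two]
  linear_combination (G z 0 0 * G z 1 1 - G z 0 1 * G z 1 0) * hX

/-- `G G*` and `det G` have zero derivative, since `X` and `Y` are skew-Hermitian and trace-free; on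
the connected set `D` they keep their value at the origin. -/
theorem mem_specialUnitaryGroup_of_maurerCartan {D : Set ℂ} (hD : IsOpen D)
    (hDc : IsPreconnected D) (hD0 : (0 : ℂ) ∈ D) {G X Y : ℂ → Mat2} (hG : SmoothMat D G)
    (h0 : G 0 = 1) (h1 : ∀ z ∈ D, dirMat G 1 z = G z * X z)
    (h2 : ∀ z ∈ D, dirMat G I z = G z * Y z) (hX : ∀ z ∈ D, X z ∈ su2) (hY : ∀ z ∈ D, Y z ∈ su2)
    {z : ℂ} (hz : z ∈ D) : G z ∈ Matrix.specialUnitaryGroup (Fin 2) ℂ := by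
  have hprod : ∀ v w W, w ∈ D → dirMat G v w = G w * W → W ∈ su2 →
      HasDir (fun w => G w * (G w)ᴴ) 0 v w := by
    intro v w W hw e hW
    have h := (hG.hasDir hD hw v).mul (hG.hasDir hD hw v).conjTranspose
    rwa [e, Matrix.conjTranspose_mul, hW.1, neg_mul, mul_neg, mul_assoc, add_neg_cancel] at h
  have hdet : ∀ v w W, w ∈ D → dirMat G v w = G w * W → W ∈ su2 →
      HasLineDerivAt ℝ (fun w => (G w).det) 0 w v := fun v w W hw e hW =>
    hasLineDerivAt_det (e ▸ hG.hasDir hD hw v) hW.2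
  have hsdet : ContDiffOn ℝ ∞ (fun w => (G w).det) D := by
    simp only [Matrix.det_fin_two]
    exact ((hG 0 0).mul (hG 1 1)).sub ((hG 0 1).mul (hG 1 0))
  refine Matrix.mem_specialUnitaryGroup_iff.2 ⟨Matrix.mem_unitaryGroup_iff.2 ?_, ?_⟩
  · ext i j
    have h := eqOn_of_hasLineDerivAt_zero hD hDc ((hG.mul hG.conjTranspose) i j)
      (fun w hw => hprod 1 w _ hw (h1 w hw) (hX w hw) i j)
      (fun w hw => hprod I w _ hw (h2 w hw) (hY w hw) i j) hz hD0
    simp only [h0, Matrix.conjTranspose_one, mul_one] at h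
    exact h
  · have h := eqOn_of_hasLineDerivAt_zero hD hDc hsdet
      (fun w hw => hdet 1 w _ hw (h1 w hw) (hX w hw))
      (fun w hw => hdet I w _ hw (h2 w hw) (hY w hw)) hz hD0
    simpa only [h0, Matrix.det_one] using h

/-! ### The adjusted Gauss map -/

/-- The identification of trace-free Hermitian matrices with vectors in Euclidean space. -/
def pauliCoords : (Fin 2 → Fin 2 → ℂ) →L[ℝ] E3 :=
  LinearMap.toContinuousLinearMap
    { toFun := fun M => !₂[(M 0 1).re, (M 0 1).im, ((M 0 0).re - (M 1 1).re) / 2]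
      map_add' := fun M N => by
        ext i
        fin_cases i <;> (simp; try ring)
      map_smul' := fun c M => by
        ext i
        fin_cases i <;> (simp; try ring) }

theorem pauliCoords_apply (M : Mat2) :
    pauliCoords M = !₂[(M 0 1).re, (M 0 1).im, ((M 0 0).re - (M 1 1).re) / 2] := rfl

theorem pauliCoords_add_eq_smul {M N P : Mat2} {ρ : ℝ} (h : M + N = (ρ : ℂ) • P) :
    pauliCoords M + pauliCoords N = ρ • pauliCoords P := by
  refine (map_add pauliCoords M N).symm.trans
    ((congrArg pauliCoords (h.trans ?_)).trans (map_smul pauliCoords ρ P))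
  ext i j
  exact (Complex.real_smul (x := ρ) (z := P i j)).symm

theorem HasDir.pauliCoords {P : ℂ → Mat2} {P' : Mat2} {v z : ℂ} (h : HasDir P P' v z) :
    HasLineDerivAt ℝ (fun w => pauliCoords (P w)) (CMCHyp.pauliCoords P') z v :=
  CMCHyp.pauliCoords.hasFDerivAt.comp_hasDerivAt (0 : ℝ)
    (hasDerivAt_pi.2 fun i => hasDerivAt_pi.2 fun j => h i j)

theorem SmoothMat.contDiffOn_pauliCoords {D : Set ℂ} {P : ℂ → Mat2} (h : SmoothMat D P) :
    ContDiffOn ℝ ∞ (fun w => pauliCoords (P w)) D :=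
  pauliCoords.contDiff.comp_contDiffOn (contDiffOn_pi.2 fun i => contDiffOn_pi.2 fun j => h i j)

/-- For a trace-free Hermitian matrix with coordinates `x`, the square is `|x|²` times the identity.
-/
theorem norm_pauliCoords_eq_one {P : Mat2} (hP : Pᴴ = P) (ht : P.trace = 0) (h : P * P = 1) :
    ‖pauliCoords P‖ = 1 := by
  have e0 := congrFun (congrFun h 0) 0
  have e1 := congrFun (congrFun hP 1) 0
  have e2 := congrFun (congrFun hP 0) 0
  rw [Matrix.trace_fin_two] at ht
  simp only [Matrix.mul_apply, Fin.sum_univ_two, Matrix.one_apply_eq] at e0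
  simp only [Matrix.conjTranspose_apply] at e1 e2
  rw [← e1] at e0
  have i2 := congrArg Complex.im e2
  have r0 := congrArg Complex.re e0
  have rt := congrArg Complex.re ht
  simp only [RCLike.star_def, conj_im, conj_re, Complex.add_re, Complex.mul_re, Complex.one_re,
    Complex.zero_re] at i2 r0 rt
  have h1 : (P 1 1).re = -(P 0 0).re := by linarith
  have h2 : (P 0 0).im = 0 := by linarith
  rw [h2] at r0
  have : ‖pauliCoords P‖ ^ 2 = 1 := by
    rw [EuclideanSpace.real_norm_sq_eq, Fin.sum_univ_three, pauliCoords_apply, h1]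
    simp
    linarith
  exact (pow_eq_one_iff_of_nonneg (norm_nonneg _) two_ne_zero).1 this

theorem laplacian_eq_of_hasLineDerivAt {E : Type*} [NormedAddCommGroup E] [NormedSpace ℝ E]
    {D : Set ℂ} (hD : IsOpen D) {N V W : ℂ → E} (hN : ContDiffOn ℝ ∞ N D)
    (hV : ∀ w ∈ D, HasLineDerivAt ℝ N (V w) w 1) (hW : ∀ w ∈ D, HasLineDerivAt ℝ N (W w) w I)
    {z : ℂ} (hz : z ∈ D) {V' W' : E} (hV' : HasLineDerivAt ℝ V V' z 1)
    (hW' : HasLineDerivAt ℝ W W' z I) : Δ N z = V' + W' := by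
  have key : ∀ (v : ℂ) (U : ℂ → E) (U' : E), (∀ w ∈ D, HasLineDerivAt ℝ N (U w) w v) →
      HasLineDerivAt ℝ U U' z v → fderiv ℝ (fderiv ℝ N) z v v = U' := by
    intro v U U' hU hU'
    have hd : DifferentiableAt ℝ (fderiv ℝ N) z :=
      differentiableAt_of_contDiffOn hD (hN.fderiv_of_isOpen hD (by simp)) hz
    have h1 : HasFDerivAt (fun w => fderiv ℝ N w v) ((fderiv ℝ (fderiv ℝ N) z).flip v) z := by
      simpa using hd.hasFDerivAt.clm_apply (hasFDerivAt_const v z)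
    have h2 : HasLineDerivAt ℝ (fun w => fderiv ℝ N w v) U' z v :=
      hU'.congr_of_eventuallyEq (Filter.eventuallyEq_of_mem (hD.mem_nhds hz) fun w hw =>
        HasDerivAt.unique (hasLineDerivAt_fderiv hD hN hw v) (hU w hw))
    exact HasDerivAt.unique (h1.hasLineDerivAt v) h2
  rw [InnerProductSpace.laplacian_eq_iteratedFDeriv_complexPlane]
  simp only [iteratedFDeriv_two_apply]
  rw [← key 1 V V' hV hV', ← key I W W' hW hW']
  rfl

theorem HasDir.conj_frame {G W : ℂ → Mat2} {X W' : Mat2} {v z : ℂ} (hG : HasDir G (G z * X) v z)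
    (hX : Xᴴ = -X) (hW : HasDir W W' v z) :
    HasDir (fun w => G w * W w * (G w)ᴴ) (G z * (X * W z - W z * X + W') * (G z)ᴴ) v z := by
  have h := (hG.mul hW).mul hG.conjTranspose
  rw [Matrix.conjTranspose_mul, hX] at h
  convert h using 1
  noncomm_ring

/-- The Laplacian of `G σ₃ G*` is `G (...) G*` with `[X, [X, σ₃]] + [X_x, σ₃] + [Y, [Y, σ₃]] + [Y_y,
σ₃]` inside. By `hρ` it is `ρ` times the map, hence normal to the sphere. -/
theorem isHarmonicToS2_of_frame {D : Set ℂ} (hD : IsOpen D) {G X Y X' Y' : ℂ → Mat2}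
    (hG : SmoothMat D G) (hSU : ∀ z ∈ D, G z ∈ Matrix.specialUnitaryGroup (Fin 2) ℂ)
    (h1 : ∀ z ∈ D, dirMat G 1 z = G z * X z) (h2 : ∀ z ∈ D, dirMat G I z = G z * Y z)
    (hX : ∀ z ∈ D, X z ∈ su2) (hY : ∀ z ∈ D, Y z ∈ su2)
    (hX' : ∀ z ∈ D, HasDir X (X' z) 1 z) (hY' : ∀ z ∈ D, HasDir Y (Y' z) I z)
    (hρ : ∀ z ∈ D, ∃ ρ : ℝ,
      X z * (X z * sigma3 - sigma3 * X z) - (X z * sigma3 - sigma3 * X z) * X z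
        + (X' z * sigma3 - sigma3 * X' z)
        + (Y z * (Y z * sigma3 - sigma3 * Y z) - (Y z * sigma3 - sigma3 * Y z) * Y z
        + (Y' z * sigma3 - sigma3 * Y' z)) = (ρ : ℂ) • sigma3) :
    IsHarmonicToS2 D (fun z => projS2 (G z)) := by
  have hGG : ∀ z ∈ D, G z * (G z)ᴴ = 1 := fun z hz =>
    Matrix.mem_unitaryGroup_iff.1 (Matrix.mem_specialUnitaryGroup_iff.1 (hSU z hz)).1
  have hGG' : ∀ z ∈ D, (G z)ᴴ * G z = 1 := fun z hz =>
    Matrix.mem_unitaryGroup_iff'.1 (Matrix.mem_specialUnitaryGroup_iff.1 (hSU z hz)).1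
  have hproj : ∀ z ∈ D, projS2 (G z) = pauliCoords (G z * sigma3 * (G z)ᴴ) := by
    intro z hz
    rw [projS2, Matrix.inv_eq_right_inv (hGG z hz)]
    rfl
  have hsm : SmoothMat D (fun z => G z * sigma3 * (G z)ᴴ) :=
    (hG.mul (smoothMat_const D sigma3)).mul hG.conjTranspose
  have hN : ContDiffOn ℝ ∞ (fun z => projS2 (G z)) D :=
    hsm.contDiffOn_pauliCoords.congr fun z hz => hproj z hz
  have hnorm : ∀ z ∈ D, ‖projS2 (G z)‖ = 1 := by
    intro z hz
    have hS : sigma3ᴴ = sigma3 := by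
      ext i j
      fin_cases i <;> fin_cases j <;> simp [sigma3]
    rw [hproj z hz]
    refine norm_pauliCoords_eq_one ?_ ?_ ?_
    · rw [Matrix.conjTranspose_mul, Matrix.conjTranspose_mul, Matrix.conjTranspose_conjTranspose,
        hS, mul_assoc]
    · rw [Matrix.trace_mul_comm, ← mul_assoc, hGG' z hz, one_mul, Matrix.trace_fin_two]
      simp [sigma3]
    · calc G z * sigma3 * (G z)ᴴ * (G z * sigma3 * (G z)ᴴ)
          = G z * sigma3 * ((G z)ᴴ * G z) * sigma3 * (G z)ᴴ := by noncomm_ring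
        _ = G z * (sigma3 * sigma3) * (G z)ᴴ := by rw [hGG' z hz]; noncomm_ring
        _ = 1 := by rw [sigma3_mul_self, mul_one, hGG z hz]
  refine ⟨hN, fun z hz => by simpa using hnorm z hz, fun z hz => ?_⟩
  obtain ⟨ρ, hρ⟩ := hρ z hz
  have first : ∀ v w W, w ∈ D → dirMat G v w = G w * W → W ∈ su2 →
      HasLineDerivAt ℝ (fun z => projS2 (G z))
        (pauliCoords (G w * (W * sigma3 - sigma3 * W) * (G w)ᴴ)) w v := by
    intro v w W hw e hW
    have h0 := hG.hasDir hD hw v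
    rw [e] at h0
    have h := h0.conj_frame hW.1 (hasDir_const sigma3)
    rw [add_zero] at h
    exact h.pauliCoords.congr_of_eventuallyEq
      (Filter.eventuallyEq_of_mem (hD.mem_nhds hw) fun w hw => hproj w hw)
  have second : ∀ v (Z : ℂ → Mat2) Z', dirMat G v z = G z * Z z → Z z ∈ su2 → HasDir Z Z' v z →
      HasLineDerivAt ℝ
        (fun w => pauliCoords (G w * (Z w * sigma3 - sigma3 * Z w) * (G w)ᴴ))
        (pauliCoords (G z * (Z z * (Z z * sigma3 - sigma3 * Z z)
          - (Z z * sigma3 - sigma3 * Z z) * Z z + (Z' * sigma3 - sigma3 * Z')) * (G z)ᴴ)) z v := by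
    intro v Z Z' e hZ hZ'
    have h0 := hG.hasDir hD hz v
    rw [e] at h0
    have h3 := (hZ'.mul (hasDir_const sigma3)).sub ((hasDir_const sigma3).mul hZ')
    rw [mul_zero, add_zero, zero_mul, zero_add] at h3
    exact (h0.conj_frame hZ.1 h3).pauliCoords
  have hΔ : Δ (fun z => projS2 (G z)) z = ρ • projS2 (G z) := by
    rw [laplacian_eq_of_hasLineDerivAt hD hN (fun w hw => first 1 w _ hw (h1 w hw) (hX w hw))
      (fun w hw => first I w _ hw (h2 w hw) (hY w hw)) hz
      (second 1 X _ (h1 z hz) (hX z hz) (hX' z hz)) (second I Y _ (h2 z hz) (hY z hz) (hY' z hz)),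
      hproj z hz]
    refine pauliCoords_add_eq_smul ?_
    rw [← add_mul, ← mul_add, hρ, mul_smul_comm, smul_mul_assoc]
  rw [hΔ, real_inner_smul_left, real_inner_self_eq_norm_sq, hnorm z hz, one_pow, mul_one, sub_self]

end CMCHyp
end

noncomputable section

namespace CMCHyp

/-! ### The adjusted frame and the theorem -/

theorem twX_mem_su2 (u : ℂ → ℝ) (Q : ℂ → ℂ) (b : ℝ) (θ : Circle) (z : ℂ) :
    twX u Q (-b) b θ z ∈ su2 := by
  have hθ : conj (θ : ℂ) = (θ : ℂ)⁻¹ := (Circle.coe_inv_eq_conj θ).symm.trans (Circle.coe_inv θ)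
  constructor
  · ext i j
    fin_cases i <;> fin_cases j <;> simp [twX, hθ, -Complex.ofReal_exp] <;> ring
  · simp [twX, Matrix.trace_fin_two]

theorem twY_mem_su2 (u : ℂ → ℝ) (Q : ℂ → ℂ) (b : ℝ) (θ : Circle) (z : ℂ) :
    twY u Q (-b) b θ z ∈ su2 := by
  have hθ : conj (θ : ℂ) = (θ : ℂ)⁻¹ := (Circle.coe_inv_eq_conj θ).symm.trans (Circle.coe_inv θ)
  constructor
  · ext i j
    fin_cases i <;> fin_cases j <;> simp [twY, hθ, -Complex.ofReal_exp] <;> ring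
  · simp [twY, Matrix.trace_fin_two]

/-- The double commutators supply the diagonal part. Off the diagonal, their products with `du`
cancel against derivatives of `e^{±u}`, and Codazzi removes what is left; the Gauss equation plays
no role, and `a`, `b`, `l` are arbitrary. -/
theorem twX_twY_tension {u : ℂ → ℝ} {Q : ℂ → ℂ} {a b ab : ℝ} {l z : ℂ}
    (h : GaussCodazziAt u Q ab z) :
    twX u Q a b l z * (twX u Q a b l z * sigma3 - sigma3 * twX u Q a b l z)
        - (twX u Q a b l z * sigma3 - sigma3 * twX u Q a b l z) * twX u Q a b l z
      + (twX' u Q a b l 1 z * sigma3 - sigma3 * twX' u Q a b l 1 z)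
      + (twY u Q a b l z * (twY u Q a b l z * sigma3 - sigma3 * twY u Q a b l z)
        - (twY u Q a b l z * sigma3 - sigma3 * twY u Q a b l z) * twY u Q a b l z
      + (twY' u Q a b l I z * sigma3 - sigma3 * twY' u Q a b l I z))
    = (4 * (twX u Q a b l z 0 1 * twX u Q a b l z 1 0
      + twY u Q a b l z 0 1 * twY u Q a b l z 1 0)) • sigma3 := by
  have hc := h.codazzi
  have hc' := congrArg conj hc
  simp only [map_add, map_mul, conj_I, map_zero] at hc'
  have hI : I ^ 2 = -1 := I_sq
  ext i j
  fin_cases i <;> fin_cases j <;>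
    simp only [twX, twY, twX', twY', sigma3, Matrix.add_apply, Matrix.sub_apply, Matrix.mul_apply,
      Matrix.smul_apply, smul_eq_mul,
      Fin.sum_univ_two, Matrix.of_apply, Matrix.cons_val', Matrix.cons_val_zero, Matrix.cons_val_one,
      Fin.zero_eta, Fin.mk_one, Fin.isValue, Matrix.cons_val_fin_one]
  · ring
  · linear_combination (2 * l⁻¹ * (Real.exp (-1 * u z) : ℝ)) * hc - (fderiv ℝ u z 1 : ℝ) *
      (l * (Real.exp (1 * u z) : ℝ) * b + 2 * l⁻¹ * (Real.exp (-1 * u z) : ℝ) * Q z) * hI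
  · linear_combination (2 * l * (Real.exp (-1 * u z) : ℝ)) * hc' + (fderiv ℝ u z 1 : ℝ) *
      (l⁻¹ * (Real.exp (1 * u z) : ℝ) * a - 2 * l * (Real.exp (-1 * u z) : ℝ) * conj (Q z)) * hI
  · ring

/-- In `su(2)` the off-diagonal entries satisfy `M 0 1 = -conj (M 1 0)`, so their product is real.
-/
theorem exists_real_tension {u : ℂ → ℝ} {Q : ℂ → ℂ} {b : ℝ} (θ : Circle) (z : ℂ) :
    ∃ ρ : ℝ, (ρ : ℂ) = 4 * (twX u Q (-b) b θ z 0 1 * twX u Q (-b) b θ z 1 0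
      + twY u Q (-b) b θ z 0 1 * twY u Q (-b) b θ z 1 0) := by
  have key : ∀ M : Mat2, M ∈ su2 → M 0 1 * M 1 0 = ((-normSq (M 1 0) : ℝ) : ℂ) := by
    intro M hM
    have h := congrFun (congrFun hM.1 0) 1
    simp only [Matrix.conjTranspose_apply, Matrix.neg_apply, RCLike.star_def] at h
    rw [ofReal_neg, normSq_eq_conj_mul_self, h]
    ring
  rw [key _ (twX_mem_su2 u Q b θ z), key _ (twY_mem_su2 u Q b θ z)]
  exact ⟨4 * (-normSq (twX u Q (-b) b θ z 1 0) + -normSq (twY u Q (-b) b θ z 1 0)), by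
    push_cast; ring⟩

/-- The frame in the annulus algebra is restricted to `|λ| = 1`. Membership in the algebra gives the
twist and the regularity for all `p` simultaneously; the values in `su(2)` give unitarity. -/
theorem exists_adjusted_frame {D : Set ℂ} (hD : IsOpen D) (hDs : IsSimplyConnected D)
    (hD0 : (0 : ℂ) ∈ D) {u : ℂ → ℝ} {Q : ℂ → ℂ} (hu : ContDiffOn ℝ ∞ u D)
    (hQ : ContDiffOn ℝ ∞ Q D) {b : ℝ} (h : ∀ z ∈ D, GaussCodazziAt u Q (-b * b) z) :
    ∃ Ft : Circle → ℂ → Mat2,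
      (∀ p, ∀ z ∈ D, (fun θ : Circle => Ft θ z) ∈ LoopSU2 p) ∧
      (∀ θ : Circle, Ft θ 0 = 1) ∧
      (∀ θ : Circle, SmoothMat D (Ft θ) ∧ ∀ z ∈ D,
        dirMat (Ft θ) 1 z = Ft θ z * twX u Q (-b) b θ z ∧
        dirMat (Ft θ) I z = Ft θ z * twY u Q (-b) b θ z) ∧
      (∀ θ : Circle, IsHarmonicToS2 D (fun z => projS2 (Ft θ z))) := by
  obtain ⟨F, hF0, hF⟩ := loopRepresentation.exists_frame spectral_ne_zero hD hDs hD0 hu hQ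
    (a := -b) (b := b) (fun z hz => by simpa only [ofReal_neg] using h z hz)
  have hval : ∀ θ z, (F z).val (unitRadius, θ) = loopRepresentation.ev (unitRadius, θ) (F z) :=
    fun θ z => rfl
  have hF' : ∀ θ : Circle, SmoothMat D (fun z => (F z).val (unitRadius, θ)) ∧ ∀ z ∈ D,
      dirMat (fun z => (F z).val (unitRadius, θ)) 1 z
        = (F z).val (unitRadius, θ) * twX u Q (-b) b θ z ∧
      dirMat (fun z => (F z).val (unitRadius, θ)) I z
        = (F z).val (unitRadius, θ) * twY u Q (-b) b θ z := by
    intro θ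
    have h1 := hF (unitRadius, θ)
    rw [spectral_unitRadius] at h1
    exact h1
  have h0 : ∀ θ : Circle, (F 0).val (unitRadius, θ) = 1 := by
    intro θ
    rw [hval, hF0, map_one]
  have hSU : ∀ θ : Circle, ∀ z ∈ D,
      (F z).val (unitRadius, θ) ∈ Matrix.specialUnitaryGroup (Fin 2) ℂ := fun θ z hz =>
    mem_specialUnitaryGroup_of_maurerCartan hD hDs.isPathConnected.isConnected.isPreconnected hD0
      (hF' θ).1 (h0 θ) (fun w hw => ((hF' θ).2 w hw).1) (fun w hw => ((hF' θ).2 w hw).2)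
      (fun w _ => twX_mem_su2 u Q b θ w) (fun w _ => twY_mem_su2 u Q b θ w) hz
  refine ⟨fun θ z => (F z).val (unitRadius, θ), fun p z hz => ⟨fun θ => hSU θ z hz,
    fun θ => loopAlgebra_twist (F z).val_mem _ θ, fun i j => loopAlgebra_isHp (F z).val_mem p i j⟩,
    h0, hF', fun θ => ?_⟩
  refine isHarmonicToS2_of_frame hD (hF' θ).1 (hSU θ) (fun w hw => ((hF' θ).2 w hw).1)
    (fun w hw => ((hF' θ).2 w hw).2) (fun w _ => twX_mem_su2 u Q b θ w)
    (fun w _ => twY_mem_su2 u Q b θ w) (fun w hw => (hasDir_twX_twY hD hu hQ (-b) b θ hw 1).1)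
    (fun w hw => (hasDir_twX_twY hD hu hQ (-b) b θ hw I).2) fun w hw => ?_
  obtain ⟨ρ, hρ⟩ := exists_real_tension (u := u) (Q := Q) (b := b) θ w
  exact ⟨ρ, (twX_twY_tension (h w hw)).trans (by rw [hρ])⟩

theorem HasMaurerCartanForm.of_dirMat {D : Set ℂ} {F A B : ℂ → Mat2} (hF : SmoothMat D F)
    (h1 : ∀ z ∈ D, dirMat F 1 z = F z * (A z + B z))
    (h2 : ∀ z ∈ D, dirMat F I z = F z * (I • (A z - B z))) : HasMaurerCartanForm D F A B := by
  refine ⟨hF, fun z hz => ?_, fun z hz => ?_⟩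
  · rw [wirtMat_eq, h1 z hz, h2 z hz, mul_smul_comm, smul_smul, I_mul_I, mul_add, mul_sub]
    module
  · rw [wirtBarMat_eq, h1 z hz, h2 z hz, mul_smul_comm, smul_smul, I_mul_I, mul_add, mul_sub]
    module

end CMCHyp
end

theorem theorem3 (D : Set ℂ) (hDo : IsOpen D) (hDs : IsSimplyConnected D) (hD0 : (0 : ℂ) ∈ D)
    (u : ℂ → ℝ) (H : ℝ) (Q : ℂ → ℂ) (hH : 1 < |H|)
    (f N : Circle → ℂ → CMCHyp.R31) (hf : CMCHyp.IsAssociatedFamily D u H Q f N)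
    (F : Circle → ℂ → CMCHyp.Mat2)
    (hF : ∀ θ : Circle, CMCHyp.IsMovingFrame D u (f θ) (N θ) (F θ))
    (p : ℝ) (hp : 1 / 2 < p) :
    -- the Maurer-Cartan form of the given frame is the undeformed form (`s = 1`)
    (∀ θ : Circle, CMCHyp.HasMaurerCartanForm D (F θ)
      (CMCHyp.defA u H Q 1 θ) (CMCHyp.defB u H Q 1 θ)) ∧
    -- `s₀` is the only positive parameter that makes the deformed form `su(2)`-valued
    0 < Real.sqrt ((H - 1) / (H + 1)) ∧
    (∀ s : ℝ, 0 < s → ∀ θ : Circle,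
      (CMCHyp.IsSu2Form D (CMCHyp.defA u H Q s θ) (CMCHyp.defB u H Q s θ) ↔
        s = Real.sqrt ((H - 1) / (H + 1)))) ∧
    -- the deformed form at `s₀` integrates to a unitary frame that lifts harmonic maps
    ∃ Ft : Circle → ℂ → CMCHyp.Mat2,
      (∀ z ∈ D, (fun θ : Circle => Ft θ z) ∈ CMCHyp.LoopSU2 p) ∧
      (∀ θ : Circle, Ft θ 0 = 1) ∧
      (∀ θ : Circle, CMCHyp.HasMaurerCartanForm D (Ft θ)
        (CMCHyp.twA u H Q (Real.sqrt ((H - 1) / (H + 1))) θ)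
        (CMCHyp.twB u H Q (Real.sqrt ((H - 1) / (H + 1))) θ)) ∧
      (∀ θ : Circle, CMCHyp.IsHarmonicToS2 D (fun z => CMCHyp.projS2 (Ft θ z))) := by
  have hu := (hf 1).smooth_u
  set s₀ := Real.sqrt ((H - 1) / (H + 1)) with hs₀
  have hpos : 0 < s₀ := Real.sqrt_pos.2 (CMCHyp.div_pos_of_one_lt_abs hH)
  have hbal : s₀ * (1 + H) = -(s₀⁻¹ * (1 - H)) :=
    (CMCHyp.deformation_balanced_iff hH hpos).2 rfl
  -- The deformation leaves `(1 + H)(1 - H)` unchanged, so the equations of the original surfaces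
  -- apply at `s₀`.
  have hGC : ∀ z ∈ D, CMCHyp.GaussCodazziAt u Q (-(s₀⁻¹ * (1 - H)) * (s₀⁻¹ * (1 - H))) z := by
    intro z hz
    have h : -(s₀⁻¹ * (1 - H)) * (s₀⁻¹ * (1 - H)) = (1 + H) * (1 - H) := by
      rw [← hbal]
      field_simp
    rw [h]
    exact CMCHyp.gaussCodazzi_of_associatedFamily hDo hf hF hz
  obtain ⟨Ft, hloop, h0, hmc, hharm⟩ := CMCHyp.exists_adjusted_frame hDo hDs hD0 hu
    (hf.contDiffOn_hopf hDo) hGC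
  refine ⟨CMCHyp.maurerCartan_of_associatedFamily hDo hf hF, hpos, fun s hs θ => ?_, Ft, hloop p,
    h0, fun θ => ?_, hharm⟩
  · exact (CMCHyp.isSu2Form_lax_iff hDo hD0 hu _ _ _).trans
      (CMCHyp.deformation_balanced_iff hH hs)
  · refine CMCHyp.HasMaurerCartanForm.of_dirMat (hmc θ).1 (fun z hz => ?_) fun z hz => ?_
    · rw [(CMCHyp.twA_twB_eq hDo hu H Q s₀ θ hz).1, hbal]
      exact ((hmc θ).2 z hz).1
    · rw [(CMCHyp.twA_twB_eq hDo hu H Q s₀ θ hz).2, hbal]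
      exact ((hmc θ).2 z hz).2
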